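/- **Setting.** Let $f:\mathbb R^d\to\mathbb R$ be twice continuously differentiable, with gradient $g(x)=\nabla f(x)$ and Hessian $H(x)=\nabla^2 f(x)$; consider $\min f(x)$ subject to $x\ge 0$. For $\delta>0$ put $\mathcal A(x,\delta)=\{i: 0\le x^i\le\delta\}$ and $\mathcal I(x,\delta)=\{i: x^i>\delta\}$. Superscripts $\mathcal A,\mathcal I$ denote subvectors and principal submatrices, and $\mathcal P$ is the projection onto $\mathbb R^d_+$. A point $x$ is *$\epsilon$-FO* if, with $\mathcal A=\mathcal A(x,\sqrt\epsilon)$ and $\mathcal I=\mathcal I(x,\sqrt\epsilon)$, $$\text{(a) } g^i\ge-\sqrt\epsilon\ \ \forall i\in\mathcal A,\qquad \text{(b) } \|\mathrm{diag}(x^{\mathcal A})g^{\mathcal A}\|\le\epsilon,\qquad \text{(c) } \|g^{\mathcal I}\|\le\epsilon$$ (conditions on an empty index set hold trivially). **MINRES$(H,g,\eta)$.** Let $\mathcal K_t=\mathrm{span}\{g,Hg,\dots,H^{t-1}g\}$, $s_t\in\arg\min_{s\in\mathcal K_t}\|Hs+g\|$, $r_t=-Hs_t-g$. In iteration $t=1,2,\dots$: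 if $r_{t-1}\ne0$ and $\langle r_{t-1},Hr_{t-1}\rangle\le 0$, return $r_{t-1}$ with label NPC; otherwise, if $\|Hr_{t-1}\|\le\eta\|Hs_{t-1}\|$, return $s_{t-1}$ with label SOL. Each iteration uses one Hessian-vector product (to extend the Lanczos process). $T_t$ denotes the $t\times t$ symmetric tridiagonal Lanczos matrix, where for $t$ larger than the grade of $g$ (the dimension of $\bigcup_t\mathcal K_t$) the last matrix produced is meant. **Algorithm.** Parameters: $\epsilon_g\in(0,1)$, $\rho\in(0,1/2)$, $\theta>0$, $\zeta\in(0,1)$, $\delta_k=\epsilon_k=\sqrt{\epsilon_g}$, $\eta=\theta\sqrt{\epsilon_g}$, and a starting point $x_0\ge0$. At $x_k$, with $\mathcal A=\mathcal A(x_k,\sqrt{\epsilon_g})$ and $\mathcal I=\mathcal I(x_k,\sqrt{\epsilon_g})$: if $\mathcal A\neq\emptyset$ and (a) or (b) fails (for $\epsilon=\epsilon_g$), the step is of Type I and $p_k^{\mathcal A}=-g_k^{\mathcal A}$; otherwise, if $\mathcal I\ne\emptyset$ and (c) fails, the step is of Type II and $p_k^{\mathcal A}=0$; otherwise terminate. In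 both types of step $p_k^{\mathcal I}$ is the output of MINRES$(H_k^{\mathcal I},g_k^{\mathcal I},\eta)$ (which is $0$ with label SOL if $g_k^{\mathcal I}=0$ or $\mathcal I=\emptyset$). The step size $\alpha_k$ is found from the initial value $1$ by backtracking with factor $\zeta$ (label SOL) or by forward/backward tracking with factor $\zeta$ (label NPC), for the criterion $$f(\mathcal P(x_k+\alpha p_k))-f(x_k)\le\rho\langle g_k^{\mathcal A},\mathcal P(x_k^{\mathcal A}+\alpha p_k^{\mathcal A})-x_k^{\mathcal A}\rangle+\alpha\rho\langle g_k^{\mathcal I},p_k^{\mathcal I}\rangle .$$ Then $x_{k+1}=\mathcal P(x_k+\alpha_kp_k)$. **Assumptions.** 1. $\|g(x)-g(y)\|\le L_g\|x-y\|$ and $\|H(x)-H(y)\|\le L_H\|x-y\|$ on $\mathbb R^d_+$, with $L_g,L_H\ge0$. 2. $f\ge f_*>-\infty$ on $\mathbb R^d_+$, and $f(x_0)-f_*\le\Delta$. 3. There is $\omega>0$ such that at every iterate every NPC direction $p$ returned by MINRES satisfies $\|p\|\ge\omega\|g_k^{\mathcal I}\|$. 4. There is $\sigma>0$ such that, whenever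 MINRES stops in an iteration $t$ with label SOL, $T_t\succeq\sigma I$. 5. There are $\tau>0$ and $\nu$ with $L_g^2/(L_g^2+\eta^2)<\nu\le1$ such that at every iterate at which the algorithm does not terminate, with $H=H_k^{\mathcal I}$ and $g=g_k^{\mathcal I}$, if $Hg\ne0$ then the following holds. Let $\Psi$ be the set of $g$-relevant eigenvalues of $H$ (those whose eigenspace is not orthogonal to $g$), let $P_S$ be the orthogonal projection onto the sum of the eigenspaces with eigenvalue in $S$, and let $G=\|P_{\Psi\setminus\{0\}}g\|^2$. At least one of these is true: (i) there are $a,b\in\Psi$ with $b<0<a$, $\min\{a,-b\}\ge\tau$ and $\|P_{\{\mu\in\Psi:\mu\ge a\text{ or }\mu\le b\}}g\|^2\ge\nu G$; (ii) there is $a\in\Psi$ with $a>0$, $a\ge\tau$ and $\|P_{\{\mu\in\Psi:\mu\ge a\}}g\|^2\ge\nu G$; (iii) there is $b\in\Psi$ with $b<0$, $-b\ge\tau$ and $\|P_{\{\mu\in\Psi:\mu\le b\}}g\|^2\ge\nu G$. **Statement.** There is a constant $C$, depending only on $L_g,L_H,\sigma,\omega,\rho,\theta,\zeta,\tau,\Delta$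 (and not on $d$, $f$, $x_0$, $\epsilon_g$ or $\nu$), such that for every dimension $d$ and every $\epsilon_g\in(0,1)$, under the assumptions above, the algorithm is well defined (no inner loop runs forever), terminates at an $\epsilon_g$-FO point $x_K\ge0$, and the total number of gradient evaluations (one at each of $x_0,\dots,x_K$) and Hessian-vector products that it uses is at most $$C\,\epsilon_g^{-3/2}\bigl(1+\log(1/\epsilon_g)\bigr)=\tilde{\mathcal O}(\epsilon_g^{-3/2}).$$ -/

import Mathlib

namespace NewtonMR

noncomputable section

/-! ### MINRES with nonpositive-curvature detection -/

section Minres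

variable {E : Type*} [NormedAddCommGroup E] [InnerProductSpace ℝ E]

/-- The Krylov subspace of degree `t`, spanned by `g, H g, …, H ^ (t - 1) g`. -/
def krylov (H : E →ₗ[ℝ] E) (g : E) (t : ℕ) : Submodule ℝ E :=
  Submodule.span ℝ {v | ∃ i < t, v = (H ^ i) g}

/-- The grade of `g` with respect to `H`: the dimension at which the Krylov subspaces stagnate. -/
def grade (H : E →ₗ[ℝ] E) (g : E) : ℕ :=
  Module.finrank ℝ (Submodule.span ℝ (Set.range fun i : ℕ => (H ^ i) g))

/-- The `t`-th MINRES iterate: a minimiser of `‖H s + g‖` over the Krylov subspace of degree `t`. -/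
def IsMinresIterate (H : E →ₗ[ℝ] E) (g : E) (t : ℕ) (s : E) : Prop :=
  s ∈ krylov H g t ∧ ∀ u ∈ krylov H g t, ‖H s + g‖ ≤ ‖H u + g‖

/-- The residual `r = -H s - g`. -/
def minresResidual (H : E →ₗ[ℝ] E) (g s : E) : E := -(H s) - g

/-- The residual is a (nonzero) direction of nonpositive curvature. -/
def NPCTest (H : E →ₗ[ℝ] E) (r : E) : Prop := r ≠ 0 ∧ inner ℝ r (H r) ≤ 0

/-- The inexactness test `‖H r‖ ≤ η ‖H s‖`, with `r` the residual of `s`. -/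
def SOLTest (H : E →ₗ[ℝ] E) (g : E) (η : ℝ) (s : E) : Prop :=
  ‖H (minresResidual H g s)‖ ≤ η * ‖H s‖

/-- The label attached to a direction returned by MINRES. -/
inductive DType
  | SOL
  | NPC

/-- `MinresReturns H g η t p D`: MINRES with inexactness tolerance `η` and curvature tolerance `0`
stops in its `t`-th iteration (`t = 1, 2, …`) and returns the direction `p` with label `D`.
Iteration `t` spends one product with `H` (namely `H v_t`, for the new Lanczos vector `v_t`) and
then tests the iterate `s_{t-1}` and its residual `r_{t-1}`, first for nonpositive curvature and
then for inexactness; a run that stops in iteration `t` has therefore spent `t` products. (If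
`g = 0`, the answer is `0` with label `SOL`, and one product is charged.) -/
def MinresReturns (H : E →ₗ[ℝ] E) (g : E) (η : ℝ) (t : ℕ) (p : E) (D : DType) : Prop :=
  1 ≤ t ∧ ∃ s : ℕ → E,
    (∀ j < t, IsMinresIterate H g j (s j)) ∧
    (∀ j < t - 1, ¬ NPCTest H (minresResidual H g (s j)) ∧ ¬ SOLTest H g η (s j)) ∧
    match D with
    | DType.NPC => NPCTest H (minresResidual H g (s (t - 1))) ∧ p = minresResidual H g (s (t - 1))
    | DType.SOL => ¬ NPCTest H (minresResidual H g (s (t - 1))) ∧ SOLTest H g η (s (t - 1)) ∧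
        p = s (t - 1)

/-- The Lanczos recursion. The entry with index `n` is `(v_n, v_{n+1}, β_{n+1})`, where `v_0 = 0`,
`β_1 = ‖g‖`, `v_1 = g / ‖g‖` and
`β_{n+1} v_{n+1} = H v_n - β_n v_{n-1} - ⟪v_n, H v_n⟫ v_n`, `‖v_{n+1}‖ = 1`. -/
def lanczos (H : E →ₗ[ℝ] E) (g : E) : ℕ → E × E × ℝ
  | 0 => (0, ‖g‖⁻¹ • g, ‖g‖)
  | n + 1 =>
    let u := (lanczos H g n).1
    let v := (lanczos H g n).2.1
    let b := (lanczos H g n).2.2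
    let q := H v - b • u - (inner ℝ v (H v) : ℝ) • v
    (v, ‖q‖⁻¹ • q, ‖q‖)

/-- The Lanczos vector `v_{n+1}`. -/
def lanczosVec (H : E →ₗ[ℝ] E) (g : E) (n : ℕ) : E := (lanczos H g n).2.1

/-- The Lanczos coefficient `β_{n+1}`. -/
def lanczosBeta (H : E →ₗ[ℝ] E) (g : E) (n : ℕ) : ℝ := (lanczos H g n).2.2

/-- The Lanczos coefficient `α_{n+1} = ⟪v_{n+1}, H v_{n+1}⟫`. -/
def lanczosAlpha (H : E →ₗ[ℝ] E) (g : E) (n : ℕ) : ℝ :=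
  inner ℝ (lanczosVec H g n) (H (lanczosVec H g n))

/-- The symmetric tridiagonal Lanczos matrix `T_t`, with diagonal `α_1, …, α_t` and off-diagonal
`β_2, …, β_t`. -/
def lanczosT (H : E →ₗ[ℝ] E) (g : E) (t : ℕ) : Matrix (Fin t) (Fin t) ℝ :=
  Matrix.of fun i j =>
    if i = j then lanczosAlpha H g i
    else if (i : ℕ) + 1 = j then lanczosBeta H g j
    else if (j : ℕ) + 1 = i then lanczosBeta H g i
    else 0

/-! ### `g`-relevant eigenvalues -/

/-- The `g`-relevant eigenvalues: those whose eigenspace is not orthogonal to `g`. -/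
def relevantEigenvalues (H : E →ₗ[ℝ] E) (g : E) : Set ℝ :=
  {μ | ∃ v ∈ Module.End.eigenspace H μ, inner ℝ v g ≠ 0}

/-- The orthogonal projection of `g` onto the sum of the eigenspaces with eigenvalue in `S`. -/
def spectralPart [FiniteDimensional ℝ E] (H : E →ₗ[ℝ] E) (S : Set ℝ) (g : E) : E :=
  (⨆ μ ∈ S, Module.End.eigenspace H μ).starProjection g

/-- The spectral condition on a pair `(H, g)`: the eigenspaces of the `g`-relevant eigenvalues from
some positive one `a ≥ τ` upwards, or from some negative one `b ≤ -τ` downwards, or both together,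
carry at least the fraction `ν` of the part of `g` that lies in the eigenspaces of the nonzero
`g`-relevant eigenvalues. -/
def SpectralCondition [FiniteDimensional ℝ E] (H : E →ₗ[ℝ] E) (g : E) (τ ν : ℝ) : Prop :=
  let Ψ := relevantEigenvalues H g
  let total := ‖spectralPart H {μ | μ ∈ Ψ ∧ μ ≠ 0} g‖ ^ 2
  (∃ a ∈ Ψ, ∃ b ∈ Ψ, 0 < a ∧ b < 0 ∧ τ ≤ min a (-b) ∧
    ν * total ≤ ‖spectralPart H {μ | μ ∈ Ψ ∧ (a ≤ μ ∨ μ ≤ b)} g‖ ^ 2) ∨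
  (∃ a ∈ Ψ, 0 < a ∧ τ ≤ a ∧ ν * total ≤ ‖spectralPart H {μ | μ ∈ Ψ ∧ a ≤ μ} g‖ ^ 2) ∨
  (∃ b ∈ Ψ, b < 0 ∧ τ ≤ -b ∧ ν * total ≤ ‖spectralPart H {μ | μ ∈ Ψ ∧ μ ≤ b} g‖ ^ 2)

end Minres

/-! ### Gradient, Hessian, active and inactive sets -/

section Problem

variable {d : ℕ}

/-- The Hessian of `f` at `x`, as the derivative of the gradient. -/
def hess (f : EuclideanSpace ℝ (Fin d) → ℝ) (x : EuclideanSpace ℝ (Fin d)) :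
    EuclideanSpace ℝ (Fin d) →L[ℝ] EuclideanSpace ℝ (Fin d) :=
  fderiv ℝ (gradient f) x

/-- The matrix of second partial derivatives of `f` at `x`. -/
def hessMatrix (f : EuclideanSpace ℝ (Fin d) → ℝ) (x : EuclideanSpace ℝ (Fin d)) :
    Matrix (Fin d) (Fin d) ℝ :=
  Matrix.of fun i j => hess f x (EuclideanSpace.single j 1) i

/-- The `δ`-active indices of `x`. -/
def active (x : EuclideanSpace ℝ (Fin d)) (δ : ℝ) : Finset (Fin d) :=
  {i | 0 ≤ x i ∧ x i ≤ δ}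

/-- The `δ`-inactive indices of `x`. -/
def inactive (x : EuclideanSpace ℝ (Fin d)) (δ : ℝ) : Finset (Fin d) :=
  {i | δ < x i}

/-- The subvector of `v` with indices in `I`. -/
def subvec (I : Finset (Fin d)) (v : EuclideanSpace ℝ (Fin d)) : EuclideanSpace ℝ I :=
  WithLp.toLp 2 fun i => v i

/-- The principal submatrix of the Hessian with indices in `I`, as a linear map. -/
def subHess (f : EuclideanSpace ℝ (Fin d) → ℝ) (I : Finset (Fin d))
    (x : EuclideanSpace ℝ (Fin d)) : EuclideanSpace ℝ I →ₗ[ℝ] EuclideanSpace ℝ I :=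
  Matrix.toEuclideanLin
    ((hessMatrix f x).submatrix (fun i : I => (i : Fin d)) (fun j : I => (j : Fin d)))

/-! ### Approximate first-order optimality -/

/-- Approximate nonnegativity of the gradient on the `√ε`-active set. -/
def ActiveSign (f : EuclideanSpace ℝ (Fin d) → ℝ) (ε : ℝ) (x : EuclideanSpace ℝ (Fin d)) : Prop :=
  ∀ i ∈ active x (√ε), -√ε ≤ gradient f x i

/-- Approximate complementarity on the `√ε`-active set. -/
def ActiveCompl (f : EuclideanSpace ℝ (Fin d) → ℝ) (ε : ℝ) (x : EuclideanSpace ℝ (Fin d)) : Prop :=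
  ‖subvec (active x (√ε)) (WithLp.toLp 2 fun i => x i * gradient f x i)‖ ≤ ε

/-- Approximate stationarity on the `√ε`-inactive set. -/
def InactiveSmall (f : EuclideanSpace ℝ (Fin d) → ℝ) (ε : ℝ) (x : EuclideanSpace ℝ (Fin d)) :
    Prop :=
  ‖subvec (inactive x (√ε)) (gradient f x)‖ ≤ ε

/-- `ε`-approximate first-order optimality; norms of subvectors with empty index set are `0`. -/
def IsFO (f : EuclideanSpace ℝ (Fin d) → ℝ) (ε : ℝ) (x : EuclideanSpace ℝ (Fin d)) : Prop :=
  ActiveSign f ε x ∧ ActiveCompl f ε x ∧ InactiveSmall f ε x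

/-! ### Line search -/

/-- Projection onto the nonnegative orthant. -/
def proj (x : EuclideanSpace ℝ (Fin d)) : EuclideanSpace ℝ (Fin d) :=
  WithLp.toLp 2 fun i => max (x i) 0

/-- The sufficient decrease criterion for the step size `a` along `p` from `x`. -/
def LineSearchCriterion (f : EuclideanSpace ℝ (Fin d) → ℝ) (ρ δ : ℝ)
    (x p : EuclideanSpace ℝ (Fin d)) (a : ℝ) : Prop :=
  f (proj (x + a • p)) - f x ≤
    ρ * inner ℝ (subvec (active x δ) (gradient f x)) (subvec (active x δ) (proj (x + a • p) - x)) +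
    a * ρ * inner ℝ (subvec (inactive x δ) (gradient f x)) (subvec (inactive x δ) p)

/-- Backward tracking from `1` with factor `ζ` returns `a`. -/
def BackTracking (crit : ℝ → Prop) (ζ a : ℝ) : Prop :=
  ∃ n : ℕ, (∀ j < n, ¬ crit (ζ ^ j)) ∧ crit (ζ ^ n) ∧ a = ζ ^ n

/-- Forward/backward tracking from `1` with factor `ζ` returns `a`. -/
def ForwardTracking (crit : ℝ → Prop) (ζ a : ℝ) : Prop :=
  (¬ crit 1 ∧ BackTracking crit ζ a) ∨
  (∃ n : ℕ, (∀ j ≤ n, crit (ζ⁻¹ ^ j)) ∧ ¬ crit (ζ⁻¹ ^ (n + 1)) ∧ a = ζ⁻¹ ^ n)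

/-! ### The algorithm, with `δ_k = ε_k = √ε` and MINRES tolerances `η = θ √ε` and `0` -/

/-- A Type I step is due at `x`. -/
def TypeI (f : EuclideanSpace ℝ (Fin d) → ℝ) (ε : ℝ) (x : EuclideanSpace ℝ (Fin d)) : Prop :=
  (active x (√ε)).Nonempty ∧ (¬ ActiveSign f ε x ∨ ¬ ActiveCompl f ε x)

/-- A Type II step is due at `x`. -/
def TypeII (f : EuclideanSpace ℝ (Fin d) → ℝ) (ε : ℝ) (x : EuclideanSpace ℝ (Fin d)) : Prop :=
  ¬ TypeI f ε x ∧ (inactive x (√ε)).Nonempty ∧ ¬ InactiveSmall f ε x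

/-- The algorithm terminates at `x`. -/
def Terminates (f : EuclideanSpace ℝ (Fin d) → ℝ) (ε : ℝ) (x : EuclideanSpace ℝ (Fin d)) : Prop :=
  ¬ TypeI f ε x ∧ ¬ TypeII f ε x

/-- The MINRES call made at `x`, on the inactive blocks of the Hessian and of the gradient. -/
def MinresCall (f : EuclideanSpace ℝ (Fin d) → ℝ) (θ ε : ℝ) (x : EuclideanSpace ℝ (Fin d))
    (t : ℕ) (p : EuclideanSpace ℝ (inactive x (√ε))) (D : DType) : Prop :=
  MinresReturns (subHess f (inactive x (√ε)) x) (subvec (inactive x (√ε)) (gradient f x))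
    (θ * √ε) t p D

/-- One iteration of the algorithm, from `x` to `y`, in which MINRES uses `t` Hessian-vector
products. -/
def Step (f : EuclideanSpace ℝ (Fin d) → ℝ) (ρ θ ζ ε : ℝ) (x y : EuclideanSpace ℝ (Fin d))
    (t : ℕ) : Prop :=
  ∃ (p : EuclideanSpace ℝ (Fin d)) (D : DType) (a : ℝ),
    ((TypeI f ε x ∧ ∀ i ∈ active x (√ε), p i = -gradient f x i) ∨
      (TypeII f ε x ∧ ∀ i ∈ active x (√ε), p i = 0)) ∧
    MinresCall f θ ε x t (subvec (inactive x (√ε)) p) D ∧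
    (match D with
      | DType.SOL => BackTracking (LineSearchCriterion f ρ (√ε) x p) ζ a
      | DType.NPC => ForwardTracking (LineSearchCriterion f ρ (√ε) x p) ζ a) ∧
    y = proj (x + a • p)

/-- `x 0, …, x K` are the first iterates of the algorithm started at `x₀`, and `hv k` is the number
of Hessian-vector products used in iteration `k`. -/
def IsRun (f : EuclideanSpace ℝ (Fin d) → ℝ) (ρ θ ζ ε : ℝ) (x₀ : EuclideanSpace ℝ (Fin d))
    (K : ℕ) (x : ℕ → EuclideanSpace ℝ (Fin d)) (hv : ℕ → ℕ) : Prop :=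
  x 0 = x₀ ∧ ∀ k < K, Step f ρ θ ζ ε (x k) (x (k + 1)) (hv k)

/-- The number of oracle calls in a run with iterates `x 0, …, x K`: one gradient evaluation at each
of these points, and the Hessian-vector products of the `K` iterations. -/
def oracleCalls (K : ℕ) (hv : ℕ → ℕ) : ℕ := (K + 1) + ∑ k ∈ Finset.range K, hv k

/-- `x` is an iterate of the algorithm started at `x₀` at which the algorithm does not stop. -/
def IsActiveIterate (f : EuclideanSpace ℝ (Fin d) → ℝ) (ρ θ ζ ε : ℝ)
    (x₀ x : EuclideanSpace ℝ (Fin d)) : Prop :=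
  ¬ Terminates f ε x ∧ ∃ K z hv, IsRun f ρ θ ζ ε x₀ K z hv ∧ z K = x

/-! ### Regularity assumptions along the iterates -/

/-- NPC directions are not shorter than `ω` times the gradient of the MINRES subproblem. -/
def ResidualRegularity (f : EuclideanSpace ℝ (Fin d) → ℝ) (ρ θ ζ ε : ℝ)
    (x₀ : EuclideanSpace ℝ (Fin d)) (ω : ℝ) : Prop :=
  ∀ x, IsActiveIterate f ρ θ ζ ε x₀ x → ∀ t p, MinresCall f θ ε x t p DType.NPC →
    ω * ‖subvec (inactive x (√ε)) (gradient f x)‖ ≤ ‖p‖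

/-- Whenever MINRES returns an SOL direction in iteration `t`, the Lanczos matrix `T_t` satisfies
`T_t ⪰ σ I`. The Lanczos recursion has at most as many steps as the grade, so for larger `t` the
matrix is the last one that it has produced. -/
def KrylovRegularity (f : EuclideanSpace ℝ (Fin d) → ℝ) (ρ θ ζ ε : ℝ)
    (x₀ : EuclideanSpace ℝ (Fin d)) (σ : ℝ) : Prop :=
  ∀ x, IsActiveIterate f ρ θ ζ ε x₀ x → ∀ t p, MinresCall f θ ε x t p DType.SOL →
    let H := subHess f (inactive x (√ε)) x
    let g := subvec (inactive x (√ε)) (gradient f x)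
    (lanczosT H g (min t (grade H g)) - σ • (1 : Matrix _ _ ℝ)).PosSemidef

/-- The spectral condition holds for every MINRES subproblem in which the gradient is not in the
null space of the Hessian. -/
def SpectralRegularity (f : EuclideanSpace ℝ (Fin d) → ℝ) (ρ θ ζ ε : ℝ)
    (x₀ : EuclideanSpace ℝ (Fin d)) (τ ν : ℝ) : Prop :=
  ∀ x, IsActiveIterate f ρ θ ζ ε x₀ x →
    let H := subHess f (inactive x (√ε)) x
    let g := subvec (inactive x (√ε)) (gradient f x)
    H g ≠ 0 → SpectralCondition H g τ ν

end Problem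

end

end NewtonMR

open NewtonMR

/-!
The first-order complexity of a projected Newton-MR method rests on three independent facts.

*MINRES output.* The residuals `r_0, r_1, …` of MINRES are `H`-conjugate and satisfy
`⟪r_i, r_j⟫ = ‖r_j‖²` for `i ≤ j`. As long as their curvature is positive they form an
`H`-orthogonal basis of the Krylov subspace, in which the iterate `s_t` has nonnegative
coefficients.
Hence `⟪s_t, r_t⟫ ≥ 0` (`inner_iterate_residual_nonneg`), and together with `T_t ⪰ σ I`
(`curvature_ge_of_posSemidef`) an SOL direction `p` satisfies `⟪g, p⟫ ≤ -⟪p, H p⟫ ≤ -σ ‖p‖²`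
(`MinresReturns.sol`). An NPC direction satisfies `⟪g, p⟫ = -‖p‖²` and `⟪p, H p⟫ ≤ 0`.

*Number of Hessian-vector products.* In an eigenbasis of `H` the residual polynomial
`(1 - λ² / L²) ^ k` is at most `1` on the whole spectrum and tiny where `|λ| ≥ τ`. Let
`κ = η² / (L² + η²)`. The inexactness test succeeds once the part of `r_t` outside the kernel of `H`
has squared norm at most `κ` times that of the same part of `g`, of which the eigenvalues of modulus
below `τ` carry at most the fraction `1 - ν ≤ κ`. Since `ν` may be arbitrarily close to the
threshold, filtering alone only
reaches `κ + δ` for small `δ`. If the test still fails, then `‖H r_t‖` is so large that the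
candidate `s_t + H r_t / L²` closes the gap (`solTest_or_solTest`). As `δ` may be chosen of order
`ε`, a number of iterations of order `1 + log (1 / ε)` suffices, uniformly in `ν`.

*Decrease of the objective.* A Type I step decreases `f` by a multiple of `ε` by a first-order
estimate (`decrease_typeI`). A Type II step decreases `f` by a multiple of `ε ^ (3 / 2)` by a
second-order estimate, unless it is a full SOL step so short that the inactive gradient at the next
point is already small (`decrease_typeII`); then the next step, if there is one, is of Type I. So
two consecutive steps always decrease `f` by a multiple of `ε ^ (3 / 2)`. As `f` is bounded below,
this bounds the number of steps of every run; and since every run that has not stopped can be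
extended (`exists_step`), the algorithm terminates.
-/

namespace NewtonMR

/-! ### Krylov subspaces -/

section Krylov

variable {E : Type*} [NormedAddCommGroup E] [InnerProductSpace ℝ E]
  {H : E →ₗ[ℝ] E} {g : E}

lemma pow_apply_mem_krylov {i t : ℕ} (h : i < t) : (H ^ i) g ∈ krylov H g t :=
  Submodule.subset_span ⟨i, h, rfl⟩

lemma krylov_le_iff {t : ℕ} {W : Submodule ℝ E} :
    krylov H g t ≤ W ↔ ∀ i < t, (H ^ i) g ∈ W := by
  refine ⟨fun h i hi => h (pow_apply_mem_krylov hi), fun h => Submodule.span_le.2 ?_⟩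
  rintro _ ⟨i, hi, rfl⟩
  exact h i hi

lemma krylov_mono {s t : ℕ} (h : s ≤ t) : krylov H g s ≤ krylov H g t :=
  krylov_le_iff.2 fun _ hi => pow_apply_mem_krylov (hi.trans_le h)

lemma self_mem_krylov {t : ℕ} (h : 0 < t) : g ∈ krylov H g t := by
  simpa using pow_apply_mem_krylov (H := H) (g := g) h

lemma map_mem_krylov {t : ℕ} {u : E} (hu : u ∈ krylov H g t) : H u ∈ krylov H g (t + 1) := by
  have : krylov H g t ≤ (krylov H g (t + 1)).comap H := krylov_le_iff.2 fun i hi => by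
    have := pow_apply_mem_krylov (H := H) (g := g) (Nat.succ_lt_succ hi)
    rwa [pow_succ', Module.End.mul_apply] at this
  exact this hu

lemma mem_krylov_zero {u : E} (hu : u ∈ krylov H g 0) : u = 0 := by
  simpa [krylov] using hu

end Krylov

/-! ### Orthogonality and conjugacy of MINRES residuals -/

section MinresIterates

variable {E : Type*} [NormedAddCommGroup E] [InnerProductSpace ℝ E]
  {H : E →ₗ[ℝ] E} {g s : E} {t : ℕ}

lemma exists_isMinresIterate [FiniteDimensional ℝ E] (H : E →ₗ[ℝ] E) (g : E) (t : ℕ) :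
    ∃ s, IsMinresIterate H g t s := by
  obtain ⟨s, hs, hs'⟩ : (((krylov H g t).map H).starProjection (-g)) ∈ (krylov H g t).map H :=
    Submodule.starProjection_apply_mem _ _
  refine ⟨s, hs, fun u hu => ?_⟩
  have h1 := Submodule.starProjection_minimal (U := (krylov H g t).map H) (-g)
  have h2 : BddBelow (Set.range fun x : (krylov H g t).map H => ‖-g - (x : E)‖) :=
    ⟨0, by rintro _ ⟨x, rfl⟩; positivity⟩
  have h3 := ciInf_le h2 ⟨H u, Submodule.mem_map_of_mem hu⟩
  rw [← h1, ← hs'] at h3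
  have e : ∀ w : E, ‖-g - H w‖ = ‖H w + g‖ := fun w => by
    rw [← norm_neg]; congr 1; abel
  simpa only [e] using h3

namespace IsMinresIterate

lemma inner_residual_map (h : IsMinresIterate H g t s) {u : E} (hu : u ∈ krylov H g t) :
    inner ℝ (minresResidual H g s) (H u) = 0 := by
  have key : ∀ c : ℝ, 0 ≤ 2 * c * inner ℝ (H s + g) (H u) + c ^ 2 * ‖H u‖ ^ 2 := fun c => by
    have h1 := h.2 (s + c • u) (add_mem h.1 (Submodule.smul_mem _ _ hu))
    have h2 : H (s + c • u) + g = (H s + g) + c • H u := by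
      rw [map_add, map_smul]; abel
    have h3 := pow_le_pow_left₀ (norm_nonneg _) h1 2
    rw [h2, norm_add_sq_real (H s + g), norm_smul, inner_smul_right, mul_pow, Real.norm_eq_abs,
      sq_abs] at h3
    linarith
  have h0 : inner ℝ (H s + g) (H u) = (0 : ℝ) := by
    set b := inner ℝ (H s + g) (H u)
    set n := ‖H u‖ ^ 2
    have hn : 0 ≤ n := by positivity
    have := key (-b / (n + 1))
    have e : 2 * (-b / (n + 1)) * b + (-b / (n + 1)) ^ 2 * n =
        -(b ^ 2 * (n + 2)) / (n + 1) ^ 2 := by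
      field_simp; ring
    rw [e, le_div_iff₀ (by positivity)] at this
    have : b ^ 2 ≤ 0 := by nlinarith [sq_nonneg b]
    exact pow_eq_zero_iff (two_ne_zero) |>.1 (le_antisymm this (sq_nonneg b))
  have e : minresResidual H g s = -(H s + g) := by rw [minresResidual]; abel
  rw [e, inner_neg_left, h0, neg_zero]

lemma residual_mem (h : IsMinresIterate H g t s) : minresResidual H g s ∈ krylov H g (t + 1) :=
  sub_mem (neg_mem (map_mem_krylov h.1)) (self_mem_krylov t.succ_pos)

lemma inner_residual_self (h : IsMinresIterate H g t s) :
    inner ℝ (minresResidual H g s) g = -‖minresResidual H g s‖ ^ 2 := by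
  have h1 := h.inner_residual_map h.1
  have h2 : g = -minresResidual H g s - H s := by rw [minresResidual]; abel
  rw [congrArg (inner ℝ (minresResidual H g s)) h2, inner_sub_right, h1, inner_neg_right,
    real_inner_self_eq_norm_sq, sub_zero]

lemma norm_residual_sq_add (h : IsMinresIterate H g t s) :
    ‖minresResidual H g s‖ ^ 2 + ‖H s‖ ^ 2 = ‖g‖ ^ 2 := by
  have h1 := h.inner_residual_map h.1
  have h2 : g = -(minresResidual H g s + H s) := by rw [minresResidual]; abel
  rw [congrArg norm h2, norm_neg, norm_add_sq_real, h1]; ring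

lemma norm_residual_le (h : IsMinresIterate H g t s) {u : E} (hu : u ∈ krylov H g t) :
    ‖minresResidual H g s‖ ≤ ‖H u + g‖ := by
  have e : minresResidual H g s = -(H s + g) := by rw [minresResidual]; abel
  rw [e, norm_neg]
  exact h.2 u hu

/-- Residuals of earlier iterates have the same inner product with a later one as the later one has
with itself. -/
lemma inner_residual_residual {t' : ℕ} {s' : E} (h : IsMinresIterate H g t s)
    (h' : IsMinresIterate H g t' s') (htt : t ≤ t') :
    inner ℝ (minresResidual H g s') (minresResidual H g s) = ‖minresResidual H g s'‖ ^ 2 := by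
  have e : minresResidual H g s = -(H s) - g := rfl
  conv_lhs => rw [e]
  rw [inner_sub_right, inner_neg_right, h'.inner_residual_map (krylov_mono htt h.1),
    h'.inner_residual_self]
  ring

/-- Distinct residuals are `H`-conjugate. -/
lemma inner_residual_map_residual (hH : H.IsSymmetric) {t' : ℕ} {s' : E}
    (h : IsMinresIterate H g t s) (h' : IsMinresIterate H g t' s') (htt : t ≠ t') :
    inner ℝ (minresResidual H g s) (H (minresResidual H g s')) = 0 := by
  rcases lt_or_gt_of_ne htt with hlt | hlt
  · rw [← hH, real_inner_comm]
    exact h'.inner_residual_map (krylov_mono hlt h.residual_mem)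
  · exact h.inner_residual_map (krylov_mono hlt h'.residual_mem)

end IsMinresIterate

/-- As long as the residuals have positive curvature, they span the Krylov subspaces. -/
lemma krylov_le_span_residuals {s : ℕ → E} (hs : ∀ j < t, IsMinresIterate H g j (s j))
    (hpos : ∀ j < t, 0 < inner ℝ (minresResidual H g (s j)) (H (minresResidual H g (s j)))) :
    krylov H g t ≤ Submodule.span ℝ (Set.range fun i : Fin t => minresResidual H g (s i)) := by
  suffices h : ∀ m ≤ t, krylov H g m ≤
      Submodule.span ℝ (Set.range fun i : Fin t => minresResidual H g (s i)) from h t le_rfl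
  intro m
  induction m with
  | zero => exact fun _ => krylov_le_iff.2 fun i hi => absurd hi (Nat.not_lt_zero i)
  | succ m ih =>
    intro hm
    have ihm := ih (Nat.le_of_succ_le hm)
    have hsm := hs m hm
    have hsub : krylov H g (m + 1) ≤ krylov H g m ⊔ Submodule.span ℝ {(H ^ m) g} :=
      krylov_le_iff.2 fun i hi => by
        rcases Nat.lt_succ_iff_lt_or_eq.1 hi with h | rfl
        · exact Submodule.mem_sup_left (pow_apply_mem_krylov h)
        · exact Submodule.mem_sup_right (Submodule.mem_span_singleton_self _)
    have hpow : (H ^ m) g ∈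
        Submodule.span ℝ (Set.range fun i : Fin t => minresResidual H g (s i)) := by
      obtain ⟨k, hk, w, hw, hkw⟩ := Submodule.mem_sup.1 (hsub hsm.residual_mem)
      obtain ⟨c, rfl⟩ := Submodule.mem_span_singleton.1 hw
      have hc : c ≠ 0 := by
        rintro rfl
        rw [zero_smul, add_zero] at hkw
        have := hsm.inner_residual_map (hkw ▸ hk)
        exact (hpos m hm).ne' this
      have hr : minresResidual H g (s m) ∈
          Submodule.span ℝ (Set.range fun i : Fin t => minresResidual H g (s i)) :=
        Submodule.subset_span ⟨⟨m, hm⟩, rfl⟩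
      have e : (H ^ m) g = c⁻¹ • (minresResidual H g (s m) - k) := by
        rw [← hkw, add_sub_cancel_left, smul_smul, inv_mul_cancel₀ hc, one_smul]
      rw [e]
      exact Submodule.smul_mem _ _ (sub_mem hr (ihm hk))
    refine hsub.trans (sup_le ihm ?_)
    rwa [Submodule.span_singleton_le_iff_mem]

/-- The `H`-conjugate residuals of positive curvature form a basis of the Krylov subspace in which
the MINRES iterate has the coefficients `(‖r_i‖² - ‖r_t‖²) / ⟪r_i, H r_i⟫ ≥ 0`. -/
lemma inner_iterate_residual_nonneg (hH : H.IsSymmetric) {s : ℕ → E}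
    (hs : ∀ j ≤ t, IsMinresIterate H g j (s j))
    (hpos : ∀ j < t, 0 < inner ℝ (minresResidual H g (s j)) (H (minresResidual H g (s j)))) :
    0 ≤ inner ℝ (minresResidual H g (s t)) (s t) := by
  have hst := hs t le_rfl
  obtain ⟨c, hc⟩ := (Submodule.mem_span_range_iff_exists_fun ℝ).1
    (krylov_le_span_residuals (fun j hj => hs j hj.le) hpos hst.1)
  have hcoef : ∀ i : Fin t, 0 ≤ c i := by
    intro i
    have h1 : inner ℝ (H (s t)) (minresResidual H g (s i)) =
        c i * inner ℝ (minresResidual H g (s i)) (H (minresResidual H g (s i))) := by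
      rw [hH]
      conv_lhs => rw [← hc]
      rw [sum_inner, Finset.sum_eq_single i]
      · rw [real_inner_smul_left]
      · intro j _ hj
        rw [real_inner_smul_left, (hs j j.2.le).inner_residual_map_residual hH (hs i i.2.le)
          (fun h => hj (Fin.ext h)), mul_zero]
      · simp
    have h2 : H (s t) = -minresResidual H g (s t) - g := by rw [minresResidual]; abel
    have h3 : 0 ≤ inner ℝ (H (s t)) (minresResidual H g (s i)) := by
      rw [h2, inner_sub_left, inner_neg_left, (hs i i.2.le).inner_residual_residual hst i.2.le,
        real_inner_comm _ g, (hs i i.2.le).inner_residual_self]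
      have := (hs i i.2.le).inner_residual_residual hst i.2.le
      have hle := real_inner_le_norm (minresResidual H g (s t)) (minresResidual H g (s i))
      rw [this] at hle
      nlinarith [norm_nonneg (minresResidual H g (s t)), norm_nonneg (minresResidual H g (s i)),
        sq_nonneg (‖minresResidual H g (s t)‖ - ‖minresResidual H g (s i)‖)]
    rw [h1] at h3
    exact nonneg_of_mul_nonneg_left h3 (hpos i i.2)
  rw [congrArg (inner ℝ (minresResidual H g (s t))) hc.symm, inner_sum]
  refine Finset.sum_nonneg fun i _ => ?_
  rw [real_inner_smul_right, (hs i i.2.le).inner_residual_residual hst i.2.le]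
  exact mul_nonneg (hcoef i) (sq_nonneg _)

end MinresIterates

/-! ### The Lanczos recursion -/

section Lanczos

variable {E : Type*} [NormedAddCommGroup E] [InnerProductSpace ℝ E] {H : E →ₗ[ℝ] E} {g : E}

lemma lanczos_fst_succ (n : ℕ) : (lanczos H g (n + 1)).1 = lanczosVec H g n := rfl

lemma norm_smul_lanczosVec_zero : ‖g‖ • lanczosVec H g 0 = g := by
  show ‖g‖ • (‖g‖⁻¹ • g) = g
  rcases eq_or_ne g 0 with rfl | h
  · simp
  · rw [smul_smul, mul_inv_cancel₀ (norm_ne_zero_iff.2 h), one_smul]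

/-- The three-term recurrence; it also holds after a breakdown, where the next vector is `0`. -/
lemma map_lanczosVec (n : ℕ) : H (lanczosVec H g n) =
    lanczosBeta H g (n + 1) • lanczosVec H g (n + 1) + lanczosAlpha H g n • lanczosVec H g n +
      lanczosBeta H g n • (lanczos H g n).1 := by
  have key : ∀ q : E, ‖q‖ • (‖q‖⁻¹ • q) = q := fun q => by
    rcases eq_or_ne q 0 with rfl | h
    · simp
    · rw [smul_smul, mul_inv_cancel₀ (norm_ne_zero_iff.2 h), one_smul]
  have : lanczosBeta H g (n + 1) • lanczosVec H g (n + 1) = H (lanczosVec H g n) -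
      lanczosBeta H g n • (lanczos H g n).1 - lanczosAlpha H g n • lanczosVec H g n :=
    key _
  rw [this]; abel

lemma norm_lanczosVec {n : ℕ} (h : lanczosVec H g n ≠ 0) : ‖lanczosVec H g n‖ = 1 := by
  have key : ∀ q : E, ‖q‖⁻¹ • q ≠ 0 → ‖‖q‖⁻¹ • q‖ = 1 := fun q hq => by
    have : q ≠ 0 := fun h => hq (by rw [h, smul_zero])
    rw [norm_smul, norm_inv, norm_norm, inv_mul_cancel₀ (norm_ne_zero_iff.2 this)]
  cases n <;> exact key _ h

lemma lanczosVec_succ_eq (n : ℕ) : lanczosVec H g (n + 1) = (lanczosBeta H g (n + 1))⁻¹ •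
    (H (lanczosVec H g n) - lanczosBeta H g n • (lanczos H g n).1 -
      lanczosAlpha H g n • lanczosVec H g n) := rfl

/-- The span of the first `n` Lanczos vectors. -/
def lanczosSpan (H : E →ₗ[ℝ] E) (g : E) (n : ℕ) : Submodule ℝ E :=
  Submodule.span ℝ (Set.range fun i : Fin n => lanczosVec H g i)

lemma lanczosVec_mem_lanczosSpan {i n : ℕ} (h : i < n) :
    lanczosVec H g i ∈ lanczosSpan H g n :=
  Submodule.subset_span ⟨⟨i, h⟩, rfl⟩

lemma lanczosSpan_le_iff {n : ℕ} {W : Submodule ℝ E} :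
    lanczosSpan H g n ≤ W ↔ ∀ i < n, lanczosVec H g i ∈ W := by
  refine ⟨fun h i hi => h (lanczosVec_mem_lanczosSpan hi), fun h => Submodule.span_le.2 ?_⟩
  rintro _ ⟨i, rfl⟩
  exact h i i.2

lemma lanczosSpan_mono {m n : ℕ} (h : m ≤ n) : lanczosSpan H g m ≤ lanczosSpan H g n :=
  lanczosSpan_le_iff.2 fun _ hi => lanczosVec_mem_lanczosSpan (hi.trans_le h)

lemma lanczos_fst_mem_lanczosSpan {i n : ℕ} (h : i ≤ n) :
    (lanczos H g i).1 ∈ lanczosSpan H g n := by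
  cases i with
  | zero => exact Submodule.zero_mem _
  | succ i => exact lanczosVec_mem_lanczosSpan h

lemma map_mem_lanczosSpan {n : ℕ} {u : E} (hu : u ∈ lanczosSpan H g n) :
    H u ∈ lanczosSpan H g (n + 1) := by
  have : lanczosSpan H g n ≤ (lanczosSpan H g (n + 1)).comap H :=
    lanczosSpan_le_iff.2 fun i hi => by
      rw [Submodule.mem_comap, map_lanczosVec]
      exact add_mem (add_mem (Submodule.smul_mem _ _ (lanczosVec_mem_lanczosSpan (by omega)))
        (Submodule.smul_mem _ _ (lanczosVec_mem_lanczosSpan (by omega))))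
        (Submodule.smul_mem _ _ (lanczos_fst_mem_lanczosSpan (by omega)))
  exact this hu

lemma pow_apply_mem_lanczosSpan (i : ℕ) : (H ^ i) g ∈ lanczosSpan H g (i + 1) := by
  induction i with
  | zero =>
    rw [pow_zero, Module.End.one_apply, ← norm_smul_lanczosVec_zero (H := H) (g := g)]
    exact Submodule.smul_mem _ _ (by
      rw [norm_smul_lanczosVec_zero]; exact lanczosVec_mem_lanczosSpan (Nat.zero_lt_succ _))
  | succ i ih =>
    rw [pow_succ', Module.End.mul_apply]
    exact map_mem_lanczosSpan ih

lemma krylov_le_lanczosSpan (t : ℕ) : krylov H g t ≤ lanczosSpan H g t :=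
  krylov_le_iff.2 fun i hi => lanczosSpan_mono hi (pow_apply_mem_lanczosSpan i)

/-- A breakdown of the Lanczos recursion makes the span of the vectors produced so far invariant
under `H`. -/
lemma pow_apply_mem_lanczosSpan_of_eq_zero {n : ℕ} (h : lanczosVec H g n = 0) (i : ℕ) :
    (H ^ i) g ∈ lanczosSpan H g n := by
  have hle : lanczosSpan H g (n + 1) ≤ lanczosSpan H g n := lanczosSpan_le_iff.2 fun i hi => by
    rcases Nat.lt_succ_iff_lt_or_eq.1 hi with hi | rfl
    · exact lanczosVec_mem_lanczosSpan hi
    · rw [h]; exact Submodule.zero_mem _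
  induction i with
  | zero => exact (lanczosSpan_mono (Nat.le_add_left 1 n)).trans hle (pow_apply_mem_lanczosSpan 0)
  | succ i ih =>
    rw [pow_succ', Module.End.mul_apply]
    exact hle (map_mem_lanczosSpan ih)

/-- The full Krylov space of `g`, spanned by all the vectors `H ^ i g`. -/
def krylovFull (H : E →ₗ[ℝ] E) (g : E) : Submodule ℝ E :=
  Submodule.span ℝ (Set.range fun i : ℕ => (H ^ i) g)

lemma map_mem_krylovFull {u : E} (hu : u ∈ krylovFull H g) : H u ∈ krylovFull H g := by
  have : krylovFull H g ≤ (krylovFull H g).comap H := Submodule.span_le.2 (by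
    rintro _ ⟨i, rfl⟩
    refine Submodule.subset_span ⟨i + 1, ?_⟩
    simp only [pow_succ', Module.End.mul_apply])
  exact this hu

lemma lanczosVec_mem_krylovFull (n : ℕ) :
    lanczosVec H g n ∈ krylovFull H g ∧ (lanczos H g n).1 ∈ krylovFull H g := by
  induction n with
  | zero =>
    refine ⟨Submodule.smul_mem _ _ (Submodule.subset_span ⟨0, ?_⟩), Submodule.zero_mem _⟩
    simp
  | succ n ih =>
    refine ⟨?_, ih.1⟩
    rw [lanczosVec_succ_eq]
    exact Submodule.smul_mem _ _ (sub_mem (sub_mem (map_mem_krylovFull ih.1)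
      (Submodule.smul_mem _ _ ih.2)) (Submodule.smul_mem _ _ ih.1))

lemma lanczosVec_ne_zero {n : ℕ} (h : n < grade H g) : lanczosVec H g n ≠ 0 := by
  intro h0
  have h1 : krylovFull H g ≤ lanczosSpan H g n := Submodule.span_le.2 (by
    rintro _ ⟨i, rfl⟩
    exact pow_apply_mem_lanczosSpan_of_eq_zero h0 i)
  have : Module.Finite ℝ (lanczosSpan H g n) := Module.Finite.span_of_finite ℝ (Set.finite_range _)
  have h2 : grade H g ≤ Module.finrank ℝ (lanczosSpan H g n) := Submodule.finrank_mono h1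
  have h3 : Module.finrank ℝ (lanczosSpan H g n) ≤ Fintype.card (Fin n) := finrank_range_le_card _
  rw [Fintype.card_fin] at h3
  omega

/-- The Lanczos vectors are orthonormal up to the grade. -/
lemma inner_lanczosVec (hH : H.IsSymmetric) {n : ℕ} (hn : n < grade H g) :
    ∀ i < n, inner ℝ (lanczosVec H g n) (lanczosVec H g i) = 0 := by
  induction n using Nat.strong_induction_on with
  | _ n ih =>
  cases n with
  | zero => exact fun i hi => absurd hi (Nat.not_lt_zero i)
  | succ n =>
    have horth : ∀ i ≤ n, ∀ j ≤ n, i ≠ j →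
        inner ℝ (lanczosVec H g i) (lanczosVec H g j) = 0 := by
      intro i hi j hj hij
      rcases lt_or_gt_of_ne hij with h | h
      · rw [real_inner_comm]; exact ih j (by omega) (by omega) i h
      · exact ih i (by omega) (by omega) j h
    have hone : ∀ i ≤ n, inner ℝ (lanczosVec H g i) (lanczosVec H g i) = 1 := fun i hi => by
      rw [real_inner_self_eq_norm_sq, norm_lanczosVec (lanczosVec_ne_zero (by omega)), one_pow]
    have hprev : ∀ k ≤ n, ∀ j ≤ n, k ≠ j + 1 →
        inner ℝ (lanczos H g k).1 (lanczosVec H g j) = 0 := by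
      intro k hk j hj hkj
      cases k with
      | zero => exact inner_zero_left _
      | succ k => exact horth k (by omega) j hj (by omega)
    intro i hi
    rw [lanczosVec_succ_eq, real_inner_smul_left, inner_sub_left, inner_sub_left,
      real_inner_smul_left, real_inner_smul_left]
    rcases Nat.lt_succ_iff_lt_or_eq.1 hi with hi | rfl
    · rw [hH, map_lanczosVec, inner_add_right, inner_add_right, real_inner_smul_right,
        real_inner_smul_right, real_inner_smul_right, horth n le_rfl i hi.le hi.ne',
        real_inner_comm, real_inner_comm (lanczos H g i).1 (lanczosVec H g n),
        hprev i hi.le n le_rfl (by omega)]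
      rcases eq_or_ne n (i + 1) with rfl | hne
      · rw [lanczos_fst_succ, hone _ le_rfl, hone i (by omega)]; ring
      · rw [horth (i + 1) hi n le_rfl hne.symm, hprev n le_rfl i hi.le hne]; ring
    · rw [hprev i le_rfl i le_rfl (by omega), hone i le_rfl, real_inner_comm]
      change _ * (lanczosAlpha H g i - _ - _) = _
      ring

lemma orthonormal_lanczosVec (hH : H.IsSymmetric) {t : ℕ} (ht : t ≤ grade H g) :
    Orthonormal ℝ fun i : Fin t => lanczosVec H g i := by
  refine ⟨fun i => norm_lanczosVec (lanczosVec_ne_zero (i.2.trans_le ht)), fun i j hij => ?_⟩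
  rcases lt_or_gt_of_ne (Fin.val_ne_of_ne hij) with h | h
  · rw [real_inner_comm]; exact inner_lanczosVec hH (j.2.trans_le ht) i h
  · exact inner_lanczosVec hH (i.2.trans_le ht) j h

lemma krylov_le_lanczosSpan_min [FiniteDimensional ℝ E] (hH : H.IsSymmetric) (t : ℕ) :
    krylov H g t ≤ lanczosSpan H g (min t (grade H g)) := by
  rcases le_total t (grade H g) with h | h
  · rw [min_eq_left h]; exact krylov_le_lanczosSpan t
  · rw [min_eq_right h]
    have h1 : lanczosSpan H g (grade H g) ≤ krylovFull H g :=
      lanczosSpan_le_iff.2 fun i _ => (lanczosVec_mem_krylovFull i).1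
    have h2 : Module.finrank ℝ (lanczosSpan H g (grade H g)) = grade H g := by
      have := finrank_span_eq_card
        (orthonormal_lanczosVec hH (le_refl (grade H g))).linearIndependent
      rwa [Fintype.card_fin] at this
    rw [Submodule.eq_of_le_of_finrank_eq h1 h2]
    exact krylov_le_iff.2 fun i _ => Submodule.subset_span ⟨i, rfl⟩

/-- The Lanczos matrix represents the compression of `H` to the span of the Lanczos vectors. -/
lemma lanczosT_apply (hH : H.IsSymmetric) {t : ℕ} (ht : t ≤ grade H g) (i j : Fin t) :
    lanczosT H g t i j = inner ℝ (lanczosVec H g i) (H (lanczosVec H g j)) := by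
  have horth : ∀ i < grade H g, ∀ j < grade H g, i ≠ j →
      inner ℝ (lanczosVec H g i) (lanczosVec H g j) = 0 := fun i hi j hj hij =>
    (orthonormal_lanczosVec hH le_rfl).2 (i := ⟨i, hi⟩) (j := ⟨j, hj⟩) (by simpa using hij)
  have hone : ∀ i < grade H g, inner ℝ (lanczosVec H g i) (lanczosVec H g i) = 1 := fun i hi => by
    rw [real_inner_self_eq_norm_sq, norm_lanczosVec (lanczosVec_ne_zero hi), one_pow]
  -- It suffices to treat the lower triangle, where the recurrence reaches no vector beyond `v_i`.
  have key : ∀ a < grade H g, ∀ b < a, inner ℝ (lanczosVec H g a) (H (lanczosVec H g b)) =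
      if b + 1 = a then lanczosBeta H g a else 0 := by
    intro a ha b hb
    have hu : inner ℝ (lanczosVec H g a) (lanczos H g b).1 = 0 := by
      cases b with
      | zero => exact inner_zero_right _
      | succ b => exact horth a ha b (by omega) (by omega)
    rw [map_lanczosVec, inner_add_right, inner_add_right, real_inner_smul_right,
      real_inner_smul_right, real_inner_smul_right, hu, horth a ha b (by omega) hb.ne']
    split_ifs with h
    · subst h; rw [hone _ ha]; ring
    · rw [horth a ha (b + 1) (by omega) (Ne.symm h)]; ring
  have hi := i.2.trans_le ht
  have hj := j.2.trans_le ht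
  rw [lanczosT, Matrix.of_apply]
  rcases lt_trichotomy (i : ℕ) j with h | h | h
  · rw [if_neg (fun e => h.ne (congrArg _ e)), ← hH, real_inner_comm, key j hj i h,
      if_neg (show ¬ (j : ℕ) + 1 = i by omega)]
  · rw [if_pos (Fin.ext h), Fin.ext h]; rfl
  · rw [if_neg (fun e => h.ne' (congrArg _ e)), key i hi j h,
      if_neg (show ¬ (i : ℕ) + 1 = j by omega)]

/-- `T_t ⪰ σ I` bounds the curvature of `H` from below on the Krylov subspace of degree `t`. -/
lemma curvature_ge_of_posSemidef [FiniteDimensional ℝ E] (hH : H.IsSymmetric) {t : ℕ} {σ : ℝ}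
    (h : (lanczosT H g (min t (grade H g)) - σ • (1 : Matrix _ _ ℝ)).PosSemidef) {u : E}
    (hu : u ∈ krylov H g t) : σ * ‖u‖ ^ 2 ≤ inner ℝ u (H u) := by
  have hm : min t (grade H g) ≤ grade H g := min_le_right _ _
  obtain ⟨c, hc⟩ := (Submodule.mem_span_range_iff_exists_fun ℝ).1
    (krylov_le_lanczosSpan_min hH t hu)
  have hpos := h.dotProduct_mulVec_nonneg c
  rw [Matrix.sub_mulVec, dotProduct_sub, Matrix.smul_mulVec, Matrix.one_mulVec] at hpos
  have h1 : star c ⬝ᵥ Matrix.mulVec (lanczosT H g (min t (grade H g))) c = inner ℝ u (H u) := by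
    rw [← hc]
    simp only [map_sum, map_smul, sum_inner, inner_sum, real_inner_smul_left,
      real_inner_smul_right, dotProduct, Matrix.mulVec, lanczosT_apply hH hm, Pi.star_apply,
      star_trivial, Finset.mul_sum]
    refine Finset.sum_congr rfl fun i _ => Finset.sum_congr rfl fun j _ => ?_
    rw [← hH (lanczosVec H g j), real_inner_comm]
    ring
  have h2 : star c ⬝ᵥ σ • c = σ * ‖u‖ ^ 2 := by
    rw [← real_inner_self_eq_norm_sq, ← hc, (orthonormal_lanczosVec hH hm).inner_sum]
    simp [dotProduct, Finset.mul_sum]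
    exact Finset.sum_congr rfl fun i _ => by ring
  rw [h1, h2] at hpos
  linarith

end Lanczos

/-! ### Eigenvalue filtering and the inexactness test -/

section Spectral

variable {E : Type*} [NormedAddCommGroup E] [InnerProductSpace ℝ E] {H : E →ₗ[ℝ] E} {g : E}
  {ι : Type*} [Fintype ι] {b : OrthonormalBasis ι ℝ E} {ev : ι → ℝ}

lemma inner_eigenbasis_map (hH : H.IsSymmetric) (hb : ∀ i, H (b i) = ev i • b i) (i : ι) (v : E) :
    inner ℝ (b i) (H v) = ev i * inner ℝ (b i) v := by
  rw [← hH, hb, real_inner_smul_left]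

lemma norm_sq_eq_sum_inner (v : E) : ‖v‖ ^ 2 = ∑ i, inner ℝ (b i) v ^ 2 := by
  rw [← b.sum_sq_norm_inner_right v]
  exact Finset.sum_congr rfl fun i _ => by rw [Real.norm_eq_abs, sq_abs]

lemma sq_eigenvalue_le (hb : ∀ i, H (b i) = ev i • b i) {L : ℝ} (hL : ∀ v, ‖H v‖ ≤ L * ‖v‖)
    (i : ι) : ev i ^ 2 ≤ L ^ 2 := by
  have := hL (b i)
  rw [hb, norm_smul, b.norm_eq_one, mul_one, mul_one, Real.norm_eq_abs] at this
  exact sq_le_sq' (by linarith [neg_abs_le (ev i)]) ((le_abs_self _).trans this)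

lemma norm_map_sq_le (hH : H.IsSymmetric) (hb : ∀ i, H (b i) = ev i • b i) {L : ℝ}
    (hL : ∀ v, ‖H v‖ ≤ L * ‖v‖) (v : E) :
    ‖H v‖ ^ 2 ≤ L ^ 2 * ∑ i, if ev i = 0 then 0 else inner ℝ (b i) v ^ 2 := by
  rw [norm_sq_eq_sum_inner (b := b), Finset.mul_sum]
  refine Finset.sum_le_sum fun i _ => ?_
  rw [inner_eigenbasis_map hH hb, mul_pow]
  split_ifs with h
  · rw [h]; simp
  · exact mul_le_mul_of_nonneg_right (sq_eigenvalue_le hb hL i) (sq_nonneg _)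

open Classical in
/-- In an orthonormal eigenbasis, the spectral part keeps the coordinates with eigenvalue in `S`. -/
lemma norm_spectralPart_sq [FiniteDimensional ℝ E] (hH : H.IsSymmetric)
    (hb : ∀ i, H (b i) = ev i • b i) (S : Set ℝ) :
    ‖spectralPart H S g‖ ^ 2 = ∑ i, if ev i ∈ S then inner ℝ (b i) g ^ 2 else 0 := by
  set w : E := ∑ i, (if ev i ∈ S then inner ℝ (b i) g else 0 : ℝ) • b i with hw
  have hcoord : ∀ i, inner ℝ (b i) w = if ev i ∈ S then inner ℝ (b i) g else 0 := fun i => by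
    rw [hw, b.orthonormal.inner_right_fintype]
  have hproj : spectralPart H S g = w := by
    refine Submodule.eq_starProjection_of_mem_of_inner_eq_zero ?_ ?_
    · refine Submodule.sum_mem _ fun i _ => ?_
      split_ifs with h
      · refine Submodule.smul_mem _ _ ?_
        exact Submodule.mem_iSup_of_mem (ev i) (Submodule.mem_iSup_of_mem h
          (Module.End.mem_eigenspace_iff.2 (hb i)))
      · rw [zero_smul]; exact Submodule.zero_mem _
    · intro z hz
      have hle : (⨆ μ ∈ S, Module.End.eigenspace H μ) ≤ (Submodule.span ℝ {g - w})ᗮ := by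
        refine iSup₂_le fun μ hμ z hz => Submodule.mem_orthogonal_singleton_iff_inner_right.2 ?_
        rw [Module.End.mem_eigenspace_iff] at hz
        rw [← b.sum_inner_mul_inner]
        refine Finset.sum_eq_zero fun i _ => ?_
        have h1 : ev i * inner ℝ (b i) z = μ * inner ℝ (b i) z := by
          rw [← inner_eigenbasis_map hH hb, hz, real_inner_smul_right]
        rcases eq_or_ne (ev i) μ with h | h
        · rw [real_inner_comm, inner_sub_right, hcoord, if_pos (h ▸ hμ), sub_self, zero_mul]
        · have : inner ℝ (b i) z = 0 := by
            by_contra h0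
            exact h (mul_right_cancel₀ h0 h1)
          rw [this, mul_zero]
      exact Submodule.mem_orthogonal_singleton_iff_inner_right.1 (hle hz)
  rw [hproj, norm_sq_eq_sum_inner (b := b)]
  refine Finset.sum_congr rfl fun i _ => ?_
  rw [hcoord]
  split_ifs <;> simp

lemma eigenvalue_mem_relevant (hb : ∀ i, H (b i) = ev i • b i) {i : ι}
    (h : inner ℝ (b i) g ≠ 0) : ev i ∈ relevantEigenvalues H g :=
  ⟨b i, Module.End.mem_eigenspace_iff.2 (hb i), h⟩

/-- All three alternatives of the spectral condition bound the weight of `g` on the eigenvalues of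
modulus at least `τ` from below, and only this bound matters for the iteration count. -/
lemma SpectralCondition.weight_ge [FiniteDimensional ℝ E] (hH : H.IsSymmetric)
    (hb : ∀ i, H (b i) = ev i • b i) {τ ν : ℝ} (h : SpectralCondition H g τ ν) :
    (∃ i, τ ≤ |ev i|) ∧
    ν * (∑ i, if ev i = 0 then 0 else inner ℝ (b i) g ^ 2) ≤
      ∑ i, if τ ≤ |ev i| then inner ℝ (b i) g ^ 2 else 0 := by
  classical
  have htot : ‖spectralPart H {μ | μ ∈ relevantEigenvalues H g ∧ μ ≠ 0} g‖ ^ 2 =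
      ∑ i, if ev i = 0 then 0 else inner ℝ (b i) g ^ 2 := by
    rw [norm_spectralPart_sq hH hb]
    refine Finset.sum_congr rfl fun i _ => ?_
    by_cases h0 : inner ℝ (b i) g = 0
    · simp [h0]
    · have := eigenvalue_mem_relevant hb h0
      by_cases h1 : ev i = 0 <;> simp [h1, this]
  have hle : ∀ S : Set ℝ, (∀ μ ∈ S, τ ≤ |μ|) → ‖spectralPart H S g‖ ^ 2 ≤
      ∑ i, if τ ≤ |ev i| then inner ℝ (b i) g ^ 2 else 0 := by
    intro S hS
    rw [norm_spectralPart_sq hH hb]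
    refine Finset.sum_le_sum fun i _ => ?_
    by_cases h1 : ev i ∈ S
    · rw [if_pos h1, if_pos (hS _ h1)]
    · rw [if_neg h1]; split_ifs <;> positivity
  have hex : ∀ μ ∈ relevantEigenvalues H g, τ ≤ |μ| → ∃ i, τ ≤ |ev i| := by
    rintro μ ⟨v, hv, hvg⟩ hμ
    rw [Module.End.mem_eigenspace_iff] at hv
    obtain ⟨i, hi⟩ : ∃ i, inner ℝ (b i) v ≠ 0 := by
      by_contra! h0
      apply hvg
      rw [← b.sum_inner_mul_inner]
      exact Finset.sum_eq_zero fun i _ => by rw [real_inner_comm, h0, zero_mul]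
    refine ⟨i, ?_⟩
    have : ev i * inner ℝ (b i) v = μ * inner ℝ (b i) v := by
      rw [← inner_eigenbasis_map hH hb, hv, real_inner_smul_right]
    rwa [mul_right_cancel₀ hi this]
  rw [← htot]
  rcases h with ⟨a, ha, c, hc, ha0, hc0, hac, h⟩ | ⟨a, ha, ha0, hτa, h⟩ | ⟨c, hc, hc0, hτc, h⟩
  · have h1 := hac.trans (min_le_left _ _)
    have h2 := hac.trans (min_le_right _ _)
    refine ⟨hex a ha (h1.trans (le_abs_self a)), h.trans (hle _ ?_)⟩
    rintro μ ⟨-, h3 | h3⟩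
    · exact (h1.trans h3).trans (le_abs_self μ)
    · exact (h2.trans (neg_le_neg h3)).trans (neg_le_abs μ)
  · refine ⟨hex a ha (hτa.trans (le_abs_self a)), h.trans (hle _ ?_)⟩
    rintro μ ⟨-, h3⟩
    exact (hτa.trans h3).trans (le_abs_self μ)
  · refine ⟨hex c hc (hτc.trans (neg_le_abs c)), h.trans (hle _ ?_)⟩
    rintro μ ⟨-, h3⟩
    exact (hτc.trans (neg_le_neg h3)).trans (neg_le_abs μ)

/-- The polynomial `(1 - H² / L²) ^ k` is an admissible residual polynomial of degree `2 k`. -/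
lemma exists_krylov_filter (hH : H.IsSymmetric) (hb : ∀ i, H (b i) = ev i • b i) {L : ℝ}
    (k : ℕ) : ∃ u ∈ krylov H g (2 * k),
      ∀ i, inner ℝ (b i) (H u + g) = (1 - ev i ^ 2 / L ^ 2) ^ k * inner ℝ (b i) g := by
  induction k with
  | zero => exact ⟨0, Submodule.zero_mem _, fun i => by simp⟩
  | succ k ih =>
    obtain ⟨u, hu, hu'⟩ := ih
    refine ⟨u - (L ^ 2)⁻¹ • (H (H u) + H g), sub_mem (krylov_mono (by omega) hu)
      (Submodule.smul_mem _ _ (add_mem ?_ ?_)), fun i => ?_⟩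
    · exact map_mem_krylov (map_mem_krylov hu)
    · exact krylov_mono (by omega) (map_mem_krylov (self_mem_krylov Nat.one_pos))
    · have e : H (u - (L ^ 2)⁻¹ • (H (H u) + H g)) + g =
          (H u + g) - (L ^ 2)⁻¹ • H (H (H u + g)) := by
        simp only [map_sub, map_smul, map_add]; abel
      rw [e, inner_sub_right, real_inner_smul_right, inner_eigenbasis_map hH hb,
        inner_eigenbasis_map hH hb, hu']
      ring

/-- One of two MINRES iterates passes the inexactness test. Filtering with `(1 - H² / L²) ^ k`
brings the nonkernel part of the squared residual down to `κ + δ` of that of `g`, where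
`κ = η² / (L² + η²)` is the threshold below which the test must succeed. If the test fails at this
stage, `H r` is so large that two more Krylov dimensions reduce the squared residual by the missing
amount. -/
lemma solTest_or_solTest [FiniteDimensional ℝ E] (hH : H.IsSymmetric) {L τ ν η : ℝ}
    (hL : ∀ v, ‖H v‖ ≤ L * ‖v‖) (hτ : 0 < τ) (hη : 0 < η)
    (hν : L ^ 2 / (L ^ 2 + η ^ 2) ≤ ν) (hspec : SpectralCondition H g τ ν) {k : ℕ}
    (hk : (1 - τ ^ 2 / L ^ 2) ^ (2 * k) * (L ^ 2 + η ^ 2) ^ 2 ≤ η ^ 2 * L ^ 2) {s s' : E}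
    (hs : IsMinresIterate H g (2 * k) s) (hs' : IsMinresIterate H g (2 * k + 2) s') :
    SOLTest H g η s ∨ SOLTest H g η s' := by
  classical
  obtain ⟨b, ev, hb⟩ : ∃ (b : OrthonormalBasis (Fin (Module.finrank ℝ E)) ℝ E)
      (ev : Fin (Module.finrank ℝ E) → ℝ), ∀ i, H (b i) = ev i • b i :=
    ⟨hH.eigenvectorBasis rfl, hH.eigenvalues rfl, fun i => by
      simp⟩
  obtain ⟨⟨i₀, hi₀⟩, hw⟩ := hspec.weight_ge hH hb
  have hτL : τ ^ 2 ≤ L ^ 2 := (by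
    rw [← sq_abs (ev i₀)]; exact pow_le_pow_left₀ hτ.le hi₀ 2 : τ ^ 2 ≤ ev i₀ ^ 2).trans
    (sq_eigenvalue_le hb hL i₀)
  have hLpos : 0 < L ^ 2 := (pow_pos hτ 2).trans_le hτL
  have hηpos : 0 < η ^ 2 := pow_pos hη 2
  set G : ℝ := ∑ i, if ev i = 0 then 0 else inner ℝ (b i) g ^ 2 with hG
  set Z : ℝ := ∑ i, if ev i = 0 then inner ℝ (b i) g ^ 2 else 0 with hZ
  set M : ℝ := ∑ i, if τ ≤ |ev i| then inner ℝ (b i) g ^ 2 else 0 with hM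
  have hG0 : 0 ≤ G := Finset.sum_nonneg fun i _ => by split_ifs <;> positivity
  have hGZ : ‖g‖ ^ 2 = Z + G := by
    rw [norm_sq_eq_sum_inner (b := b), hZ, hG, ← Finset.sum_add_distrib]
    exact Finset.sum_congr rfl fun i _ => by split_ifs <;> ring
  have hHr : ∀ w, ‖H (minresResidual H g w)‖ ^ 2 ≤ L ^ 2 * (‖minresResidual H g w‖ ^ 2 - Z) := by
    intro w
    refine (norm_map_sq_le hH hb hL _).trans_eq ?_
    congr 1
    rw [norm_sq_eq_sum_inner (b := b), hZ, ← Finset.sum_sub_distrib]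
    refine Finset.sum_congr rfl fun i _ => ?_
    split_ifs with h
    · rw [minresResidual, inner_sub_right, inner_neg_right, inner_eigenbasis_map hH hb, h]; ring
    · ring
  set δ : ℝ := (1 - τ ^ 2 / L ^ 2) ^ (2 * k) with hδ
  have hMG : G - M ≤ η ^ 2 / (L ^ 2 + η ^ 2) * G := by
    have : L ^ 2 / (L ^ 2 + η ^ 2) * G ≤ M := (mul_le_mul_of_nonneg_right hν hG0).trans hw
    have e : η ^ 2 / (L ^ 2 + η ^ 2) = 1 - L ^ 2 / (L ^ 2 + η ^ 2) := by field_simp; ring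
    rw [e]; linarith
  have hR : ‖minresResidual H g s‖ ^ 2 - Z ≤ (δ + η ^ 2 / (L ^ 2 + η ^ 2)) * G := by
    obtain ⟨u, hu, hui⟩ := exists_krylov_filter (g := g) hH hb (L := L) k
    have h1 := pow_le_pow_left₀ (norm_nonneg _) (hs.norm_residual_le hu) 2
    have h2 : ‖H u + g‖ ^ 2 ≤ Z + δ * G + (G - M) := by
      rw [norm_sq_eq_sum_inner (b := b), hZ, hG, hM, Finset.mul_sum, ← Finset.sum_add_distrib,
        ← Finset.sum_sub_distrib, ← Finset.sum_add_distrib]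
      refine Finset.sum_le_sum fun i _ => ?_
      have hc := sq_nonneg (inner ℝ (b i) g)
      have hev := sq_eigenvalue_le hb hL i
      have hq0 : 0 ≤ 1 - ev i ^ 2 / L ^ 2 := by
        rw [sub_nonneg, div_le_one hLpos]; exact hev
      have hδ0 : 0 ≤ δ := by
        rw [hδ, pow_mul]
        positivity
      rw [hui, mul_pow, ← pow_mul, mul_comm k 2]
      by_cases h0 : ev i = 0
      · simp [h0, not_le.2 hτ]
      · by_cases h1 : τ ≤ |ev i|
        · have hq : (1 - ev i ^ 2 / L ^ 2) ^ (2 * k) ≤ δ := by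
            refine pow_le_pow_left₀ hq0 ?_ _
            rw [← sq_abs (ev i)]
            gcongr
          have := mul_le_mul_of_nonneg_right hq hc
          simp only [h0, h1, if_true, if_false]
          linarith
        · have hq : (1 - ev i ^ 2 / L ^ 2) ^ (2 * k) ≤ 1 := by
            refine pow_le_one₀ hq0 ?_
            have : 0 ≤ ev i ^ 2 / L ^ 2 := by positivity
            linarith
          have := mul_le_mul_of_nonneg_right hq hc
          simp only [h0, h1, if_false]
          linarith [mul_nonneg hδ0 hc]
    linarith
  have hHs := hs.norm_residual_sq_add
  have hHs' := hs'.norm_residual_sq_add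
  refine or_iff_not_imp_left.2 fun hns => ?_
  rw [SOLTest, not_le] at hns
  have h1 : η ^ 2 * ‖H s‖ ^ 2 ≤ ‖H (minresResidual H g s)‖ ^ 2 := by
    rw [← mul_pow]; exact pow_le_pow_left₀ (by positivity) hns.le 2
  set r := minresResidual H g s with hr
  have h2 : ‖minresResidual H g s'‖ ^ 2 ≤ ‖r‖ ^ 2 - ‖H r‖ ^ 2 / L ^ 2 := by
    have hu : s + (L ^ 2)⁻¹ • H r ∈ krylov H g (2 * k + 2) :=
      add_mem (krylov_mono (by omega) hs.1)
        (Submodule.smul_mem _ _ (map_mem_krylov hs.residual_mem))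
    have e : H (s + (L ^ 2)⁻¹ • H r) + g = -(r - (L ^ 2)⁻¹ • H (H r)) := by
      rw [map_add, map_smul, hr, minresResidual]; abel
    have h3 := pow_le_pow_left₀ (norm_nonneg _) (hs'.norm_residual_le hu) 2
    have h4 : ‖H (H r)‖ ^ 2 ≤ L ^ 2 * ‖H r‖ ^ 2 := by
      rw [← mul_pow]; exact pow_le_pow_left₀ (norm_nonneg _) (hL _) 2
    rw [e, norm_neg, norm_sub_sq_real, real_inner_smul_right, ← hH, real_inner_self_eq_norm_sq,
      norm_smul, mul_pow, Real.norm_eq_abs, sq_abs] at h3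
    have h5 : (L ^ 2)⁻¹ ^ 2 * ‖H (H r)‖ ^ 2 ≤ (L ^ 2)⁻¹ ^ 2 * (L ^ 2 * ‖H r‖ ^ 2) := by gcongr
    have h6 : (L ^ 2)⁻¹ ^ 2 * (L ^ 2 * ‖H r‖ ^ 2) = ‖H r‖ ^ 2 / L ^ 2 := by field_simp
    have h7 : (L ^ 2)⁻¹ * ‖H r‖ ^ 2 = ‖H r‖ ^ 2 / L ^ 2 := by ring
    rw [h6] at h5
    rw [h7] at h3
    linarith
  set R := ‖r‖ ^ 2 - Z with hRdef
  set R' := ‖minresResidual H g s'‖ ^ 2 - Z with hRdef'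
  have hs1 : ‖H s‖ ^ 2 = G - R := by rw [hRdef]; linarith
  have hs2 : ‖H s'‖ ^ 2 = G - R' := by rw [hRdef']; linarith
  have hR' : (L ^ 2 + η ^ 2) * R' ≤ η ^ 2 * G := by
    have h3 : R' ≤ R - η ^ 2 * (G - R) / L ^ 2 := by
      have : η ^ 2 * (G - R) / L ^ 2 ≤ ‖H r‖ ^ 2 / L ^ 2 := by
        rw [← hs1]; gcongr
      rw [hRdef, hRdef']; linarith
    have h4 : L ^ 2 * R' ≤ (L ^ 2 + η ^ 2) * R - η ^ 2 * G := by
      have := mul_le_mul_of_nonneg_left h3 hLpos.le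
      have e : L ^ 2 * (R - η ^ 2 * (G - R) / L ^ 2) = (L ^ 2 + η ^ 2) * R - η ^ 2 * G := by
        rw [mul_sub, mul_div_cancel₀ _ hLpos.ne']; ring
      linarith
    have h5 : (L ^ 2 + η ^ 2) * R ≤ (L ^ 2 + η ^ 2) * δ * G + η ^ 2 * G := by
      have := mul_le_mul_of_nonneg_left hR (add_pos hLpos hηpos).le
      have e : (L ^ 2 + η ^ 2) * ((δ + η ^ 2 / (L ^ 2 + η ^ 2)) * G) =
          (L ^ 2 + η ^ 2) * δ * G + η ^ 2 * G := by
        field_simp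
      linarith
    have h6 : L ^ 2 * R' ≤ (L ^ 2 + η ^ 2) * δ * G := by linarith
    have h7 : L ^ 2 * ((L ^ 2 + η ^ 2) * R') ≤ L ^ 2 * (η ^ 2 * G) := by
      have := mul_le_mul_of_nonneg_left h6 (add_pos hLpos hηpos).le
      have h8 := mul_le_mul_of_nonneg_right hk hG0
      linarith
    exact le_of_mul_le_mul_left h7 hLpos
  have h8 : ‖H (minresResidual H g s')‖ ^ 2 ≤ (η * ‖H s'‖) ^ 2 := by
    rw [mul_pow, hs2]
    have := hHr s'
    linarith
  exact le_of_sq_le_sq h8 (by positivity)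

end Spectral

/-! ### Directions returned by MINRES -/

section MinresOutput

variable {E : Type*} [NormedAddCommGroup E] [InnerProductSpace ℝ E] {H : E →ₗ[ℝ] E} {g p : E}
  {η : ℝ} {t : ℕ}

lemma MinresReturns.le_of_solTest [FiniteDimensional ℝ E] {D : DType} {N : ℕ}
    (hN : ∀ s : ℕ → E, (∀ j, IsMinresIterate H g j (s j)) → ∃ j ≤ N, SOLTest H g η (s j))
    (h : MinresReturns H g η t p D) : t ≤ N + 1 := by
  classical
  obtain ⟨-, s, hs, hns, -⟩ := h
  choose s' hs' using exists_isMinresIterate H g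
  obtain ⟨j, hj, hj'⟩ := hN (fun j => if j < t then s j else s' j) (fun j => by
    split_ifs with hjt
    · exact hs j hjt
    · exact hs' j)
  by_contra hlt
  have hjt : j < t := by omega
  simp only [hjt, if_true] at hj'
  exact (hns j (by omega)).2 hj'

lemma exists_minresReturns [FiniteDimensional ℝ E] {N : ℕ}
    (hN : ∀ s : ℕ → E, (∀ j, IsMinresIterate H g j (s j)) → ∃ j ≤ N, SOLTest H g η (s j)) :
    ∃ t p D, MinresReturns H g η t p D := by
  classical
  choose s hs using exists_isMinresIterate H g
  have hex : ∃ j, NPCTest H (minresResidual H g (s j)) ∨ SOLTest H g η (s j) := by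
    obtain ⟨j, -, hj⟩ := hN s hs
    exact ⟨j, Or.inr hj⟩
  have hmin : ∀ j < Nat.find hex + 1 - 1,
      ¬ NPCTest H (minresResidual H g (s j)) ∧ ¬ SOLTest H g η (s j) := fun j hj =>
    not_or.1 (Nat.find_min hex hj)
  by_cases hnpc : NPCTest H (minresResidual H g (s (Nat.find hex)))
  · exact ⟨Nat.find hex + 1, _, DType.NPC, Nat.le_add_left _ _, s, fun j _ => hs j, hmin,
      hnpc, rfl⟩
  · exact ⟨Nat.find hex + 1, _, DType.SOL, Nat.le_add_left _ _, s, fun j _ => hs j, hmin,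
      hnpc, (Nat.find_spec hex).resolve_left hnpc, rfl⟩

/-- An NPC direction has nonpositive curvature, and it is a descent direction not longer than the
gradient. -/
lemma MinresReturns.npc (h : MinresReturns H g η t p DType.NPC) :
    inner ℝ p (H p) ≤ 0 ∧ inner ℝ g p = -‖p‖ ^ 2 ∧ p ≠ 0 := by
  obtain ⟨ht, s, hs, -, hnpc, rfl⟩ := h
  refine ⟨hnpc.2, ?_, hnpc.1⟩
  rw [real_inner_comm, (hs (t - 1) (by omega)).inner_residual_self]

/-- For an SOL direction `p`, the identity `⟪p, g⟫ = -⟪p, H p⟫ - ⟪p, r⟫` and `⟪p, r⟫ ≥ 0` give the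
descent property, and the inexactness test bounds the residual. -/
lemma MinresReturns.sol (hH : H.IsSymmetric) (hη : 0 ≤ η) {σ : ℝ}
    (h : MinresReturns H g η t p DType.SOL)
    (hcurv : ∀ u ∈ krylov H g t, σ * ‖u‖ ^ 2 ≤ inner ℝ u (H u)) :
    inner ℝ p (H p) ≤ -inner ℝ g p ∧ σ * ‖p‖ ^ 2 ≤ inner ℝ p (H p) ∧
      σ * ‖H p + g‖ ≤ η * ‖H p‖ := by
  obtain ⟨ht, s, hs, hns, hnpc, hsol, rfl⟩ := h
  obtain ⟨m, rfl⟩ : ∃ m, t = m + 1 := ⟨t - 1, by omega⟩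
  rw [Nat.add_sub_cancel] at *
  have hsm := hs m m.lt_succ_self
  have hpos : ∀ j < m,
      0 < inner ℝ (minresResidual H g (s j)) (H (minresResidual H g (s j))) := by
    intro j hj
    obtain ⟨h1, h2⟩ := hns j hj
    have h0 : minresResidual H g (s j) ≠ 0 := fun h0 => h2 (by
      rw [SOLTest, h0, map_zero, norm_zero]; positivity)
    exact not_le.1 fun hle => h1 ⟨h0, hle⟩
  have hrs := inner_iterate_residual_nonneg hH (fun j hj => hs j (Nat.lt_succ_of_le hj)) hpos
  have hr : H (s m) + g = -minresResidual H g (s m) := by rw [minresResidual]; abel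
  refine ⟨?_, hcurv _ (krylov_mono m.le_succ hsm.1), ?_⟩
  · have h1 : inner ℝ (H (s m) + g) (s m) ≤ 0 := by
      rw [hr, inner_neg_left]; linarith
    rw [inner_add_left, real_inner_comm] at h1
    linarith
  · rw [hr, norm_neg]
    refine le_trans ?_ hsol
    set r := minresResidual H g (s m)
    have h1 := (hcurv r hsm.residual_mem).trans (real_inner_le_norm r (H r))
    rcases eq_or_ne r 0 with h0 | h0
    · rw [h0]; simp
    · have h2 : 0 < ‖r‖ := norm_pos_iff.2 h0
      refine le_of_mul_le_mul_left ?_ h2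
      nlinarith

end MinresOutput

/-! ### The number of MINRES iterations -/

section IterationCount

/-- A filter degree of order `1 + log (1 / ε)` suffices for the tolerance `θ √ε`. -/
lemma exists_filter_degree {L τ θ : ℝ} (hτ : 0 < τ) (hθ : 0 < θ) :
    ∃ C : ℝ, 0 < C ∧ ∀ ε : ℝ, 0 < ε → ε < 1 →
      ∃ k : ℕ, (2 * k + 3 : ℝ) ≤ C * (1 + Real.log (1 / ε)) ∧
        (τ ≤ L → (1 - τ ^ 2 / L ^ 2) ^ (2 * k) * (L ^ 2 + (θ * √ε) ^ 2) ^ 2 ≤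
          (θ * √ε) ^ 2 * L ^ 2) := by
  by_cases hτL : τ ≤ L
  swap
  · refine ⟨3, by norm_num, fun ε hε hε1 => ⟨0, ?_, fun h => absurd h hτL⟩⟩
    have : 0 ≤ Real.log (1 / ε) :=
      Real.log_nonneg (by rw [one_div]; exact (one_le_inv₀ hε).2 hε1.le)
    push_cast; linarith
  have hL : 0 < L := hτ.trans_le hτL
  set x := τ ^ 2 / L ^ 2 with hx
  have hx0 : 0 < x := by positivity
  have hx1 : x ≤ 1 := (div_le_one (by positivity)).2 (pow_le_pow_left₀ hτ.le hτL 2)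
  set A := (L ^ 2 + θ ^ 2) ^ 2 / (θ ^ 2 * L ^ 2) with hA
  have hA0 : 0 < A := by positivity
  refine ⟨|Real.log A| / x + 1 / x + 5, by positivity, fun ε hε hε1 => ?_⟩
  have hlog : 0 ≤ Real.log (1 / ε) :=
    Real.log_nonneg (by rw [one_div]; exact (one_le_inv₀ hε).2 hε1.le)
  set l := Real.log (1 / ε) with hl
  refine ⟨⌈(|Real.log A| + l) / (2 * x)⌉₊, ?_, fun _ => ?_⟩
  · have h1 := (Nat.ceil_lt_add_one (show 0 ≤ (|Real.log A| + l) / (2 * x) by positivity)).le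
    have h2 : 2 * ((|Real.log A| + l) / (2 * x) + 1) + 3 = |Real.log A| / x + l / x + 5 := by
      field_simp; ring
    have h3 : (|Real.log A| / x + 1 / x + 5) * (1 + l) =
        |Real.log A| / x + l / x + 5 + (1 / x + |Real.log A| / x * l + 5 * l) := by
      field_simp; ring
    have h4 : 0 ≤ 1 / x + |Real.log A| / x * l + 5 * l := by positivity
    linarith
  · set k := ⌈(|Real.log A| + l) / (2 * x)⌉₊ with hk
    have h1 : (|Real.log A| + l) / (2 * x) ≤ k := Nat.le_ceil _
    have h2 : Real.log A + l ≤ 2 * k * x := by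
      rw [div_le_iff₀ (by positivity)] at h1
      linarith [le_abs_self (Real.log A)]
    have h3 : (1 - x) ^ (2 * k) ≤ ε / A := by
      calc (1 - x) ^ (2 * k) ≤ Real.exp (-x) ^ (2 * k) :=
            pow_le_pow_left₀ (by linarith) (by linarith [Real.add_one_le_exp (-x)]) _
        _ = Real.exp (-(2 * k * x)) := by
            rw [← Real.exp_nat_mul]; congr 1; push_cast; ring
        _ ≤ Real.exp (-(Real.log A + l)) := Real.exp_le_exp.2 (by linarith)
        _ = ε / A := by
            rw [neg_add, Real.exp_add, Real.exp_neg, Real.exp_log hA0, hl, one_div, Real.log_inv,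
              neg_neg, Real.exp_log hε]
            field_simp
    have hη : (θ * √ε) ^ 2 = θ ^ 2 * ε := by rw [mul_pow, Real.sq_sqrt hε.le]
    rw [hη]
    calc (1 - x) ^ (2 * k) * (L ^ 2 + θ ^ 2 * ε) ^ 2
        ≤ ε / A * (L ^ 2 + θ ^ 2) ^ 2 := by
          have : θ ^ 2 * ε ≤ θ ^ 2 := mul_le_of_le_one_right (by positivity) hε1.le
          gcongr
      _ = θ ^ 2 * ε * L ^ 2 := by rw [hA]; field_simp

/-- MINRES on a subproblem that satisfies the spectral condition passes the inexactness test within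
`2 k + 2` iterations. -/
lemma exists_solTest {E : Type*} [NormedAddCommGroup E] [InnerProductSpace ℝ E]
    [FiniteDimensional ℝ E] {H : E →ₗ[ℝ] E} {g : E} (hH : H.IsSymmetric) {L τ ν η : ℝ}
    (hL0 : 0 ≤ L) (hL : ∀ v, ‖H v‖ ≤ L * ‖v‖) (hτ : 0 < τ) (hη : 0 < η)
    (hν : L ^ 2 / (L ^ 2 + η ^ 2) ≤ ν) (hspec : H g ≠ 0 → SpectralCondition H g τ ν) {k : ℕ}
    (hk : τ ≤ L → (1 - τ ^ 2 / L ^ 2) ^ (2 * k) * (L ^ 2 + η ^ 2) ^ 2 ≤ η ^ 2 * L ^ 2)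
    (s : ℕ → E) (hs : ∀ j, IsMinresIterate H g j (s j)) :
    ∃ j ≤ 2 * k + 2, SOLTest H g η (s j) := by
  by_cases h0 : H g = 0
  · refine ⟨0, Nat.zero_le _, ?_⟩
    have h1 : s 0 = 0 := mem_krylov_zero (hs 0).1
    simp [SOLTest, minresResidual, h1, h0]
  · have hτL : τ ≤ L := by
      have hb : ∀ i, H (hH.eigenvectorBasis rfl i) =
          (hH.eigenvalues rfl i : ℝ) • hH.eigenvectorBasis rfl i := fun i => by simp
      obtain ⟨⟨i, hi⟩, -⟩ := (hspec h0).weight_ge hH hb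
      exact hi.trans (abs_le_of_sq_le_sq (sq_eigenvalue_le hb hL i) hL0)
    rcases solTest_or_solTest hH hL hτ hη hν (hspec h0) (hk hτL) (hs (2 * k)) (hs (2 * k + 2))
      with h | h
    · exact ⟨2 * k, by omega, h⟩
    · exact ⟨2 * k + 2, le_rfl, h⟩

end IterationCount

/-! ### Taylor estimates on the orthant -/

section Calculus

variable {d : ℕ} {f : EuclideanSpace ℝ (Fin d) → ℝ}

lemma hasFDerivAt_innerSL_gradient (hf : ContDiff ℝ 2 f) (x : EuclideanSpace ℝ (Fin d)) :
    HasFDerivAt f (innerSL ℝ (gradient f x)) x :=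
  (hf.differentiable (by norm_num) x).hasGradientAt.hasFDerivAt

lemma contDiff_gradient (hf : ContDiff ℝ 2 f) : ContDiff ℝ 1 (gradient f) :=
  (InnerProductSpace.toDual ℝ (EuclideanSpace ℝ (Fin d))).symm.toContinuousLinearEquiv.contDiff.comp
    (hf.fderiv_right (by norm_num))

lemma hasFDerivAt_gradient (hf : ContDiff ℝ 2 f) (x : EuclideanSpace ℝ (Fin d)) :
    HasFDerivAt (gradient f) (hess f x) x :=
  ((contDiff_gradient hf).differentiable (by norm_num) x).hasFDerivAt

lemma inner_hess_comm (hf : ContDiff ℝ 2 f) (x u v : EuclideanSpace ℝ (Fin d)) :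
    inner ℝ (hess f x u) v = inner ℝ u (hess f x v) := by
  have h1 : ∀ u v, inner ℝ (hess f x u) v = fderiv ℝ (fderiv ℝ f) x u v := by
    intro u v
    have h2 : HasFDerivAt (fun z => innerSL ℝ (gradient f z)) ((innerSL ℝ).comp (hess f x)) x :=
      (innerSL ℝ).hasFDerivAt.comp x (hasFDerivAt_gradient hf x)
    have h3 : (fun z => innerSL ℝ (gradient f z)) = fderiv ℝ f :=
      funext fun z => (hasFDerivAt_innerSL_gradient hf z).fderiv.symm
    rw [h3] at h2
    rw [h2.fderiv]
    rfl
  have hsymm : IsSymmSndFDerivAt ℝ f x := hf.contDiffAt.isSymmSndFDerivAt (by simp)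
  rw [h1, hsymm u v, ← h1, real_inner_comm]

lemma convex_orthant : Convex ℝ {x : EuclideanSpace ℝ (Fin d) | ∀ i, 0 ≤ x i} := by
  intro x hx y hy a b ha hb _ i
  have h1 := mul_nonneg ha (hx i)
  have h2 := mul_nonneg hb (hy i)
  simpa using add_nonneg h1 h2

lemma norm_hess_le (hf : ContDiff ℝ 2 f) {L : ℝ} (hL0 : 0 ≤ L)
    (hL : ∀ x y : EuclideanSpace ℝ (Fin d), (∀ i, 0 ≤ x i) → (∀ i, 0 ≤ y i) →
      ‖gradient f x - gradient f y‖ ≤ L * ‖x - y‖)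
    {x : EuclideanSpace ℝ (Fin d)} (hx : ∀ i, 0 ≤ x i) : ‖hess f x‖ ≤ L := by
  have hint : ∀ z : EuclideanSpace ℝ (Fin d), (∀ i, 0 < z i) → ‖hess f z‖ ≤ L := by
    intro z hz
    refine norm_fderiv_le_of_lip' ℝ hL0 ?_
    have : ∀ᶠ y : EuclideanSpace ℝ (Fin d) in nhds z, ∀ i, 0 < y i :=
      Filter.eventually_all.2 fun i =>
        (continuous_apply i |>.comp (PiLp.continuous_ofLp 2 _)).continuousAt.eventually
          (lt_mem_nhds (hz i))
    filter_upwards [this] with y hy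
    exact hL y z (fun i => (hy i).le) (fun i => (hz i).le)
  -- The Lipschitz condition says nothing beyond the boundary, which is reached by continuity.
  set e : EuclideanSpace ℝ (Fin d) := WithLp.toLp 2 fun _ => 1
  have hcont : Continuous fun t : ℝ => ‖hess f (x + t • e)‖ :=
    (((contDiff_gradient hf).continuous_fderiv (by norm_num)).comp (by fun_prop)).norm
  have hlim : Filter.Tendsto (fun t : ℝ => ‖hess f (x + t • e)‖) (nhdsWithin 0 (Set.Ioi 0))
      (nhds ‖hess f x‖) := by
    have := hcont.tendsto 0
    rw [zero_smul, add_zero] at this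
    exact this.mono_left nhdsWithin_le_nhds
  refine le_of_tendsto hlim ?_
  filter_upwards [self_mem_nhdsWithin] with t ht
  refine hint _ fun i => ?_
  have : (x + t • e) i = x i + t := by simp [e]
  rw [this]
  exact add_pos_of_nonneg_of_pos (hx i) ht

/-- With `r = ‖y - x‖` this set contains `x` and `y`; the mean value inequality on it gives the
Taylor estimates below, with constants that are not the sharp ones. -/
lemma convex_orthant_inter_ball (x : EuclideanSpace ℝ (Fin d)) (r : ℝ) :
    Convex ℝ ({z : EuclideanSpace ℝ (Fin d) | ∀ i, 0 ≤ z i} ∩ Metric.closedBall x r) :=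
  convex_orthant.inter (convex_closedBall x r)

lemma taylor_first (hf : ContDiff ℝ 2 f) {L : ℝ} (hL0 : 0 ≤ L)
    (hL : ∀ x y : EuclideanSpace ℝ (Fin d), (∀ i, 0 ≤ x i) → (∀ i, 0 ≤ y i) →
      ‖gradient f x - gradient f y‖ ≤ L * ‖x - y‖)
    {x y : EuclideanSpace ℝ (Fin d)} (hx : ∀ i, 0 ≤ x i) (hy : ∀ i, 0 ≤ y i) :
    f y - f x ≤ inner ℝ (gradient f x) (y - x) + L * ‖y - x‖ ^ 2 := by
  have key := (convex_orthant_inter_ball x ‖y - x‖).norm_image_sub_le_of_norm_hasFDerivWithin_le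
    (f := fun z => f z - innerSL ℝ (gradient f x) z)
    (f' := fun z => innerSL ℝ (gradient f z) - innerSL ℝ (gradient f x)) (C := L * ‖y - x‖)
    (fun z _ => ((hasFDerivAt_innerSL_gradient hf z).sub
      (innerSL ℝ (gradient f x)).hasFDerivAt).hasFDerivWithinAt)
    (fun z hz => by
      rw [← map_sub, innerSL_apply_norm]
      refine (hL z x hz.1 hx).trans ?_
      have := mem_closedBall_iff_norm.1 hz.2
      gcongr)
    ⟨hx, Metric.mem_closedBall_self (norm_nonneg _)⟩ ⟨hy, mem_closedBall_iff_norm.2 le_rfl⟩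
  have h1 := (le_abs_self _).trans key
  simp only [innerSL_apply_apply] at h1
  rw [inner_sub_right]
  linarith

lemma norm_gradient_sub_le (hf : ContDiff ℝ 2 f) {L : ℝ} (hL0 : 0 ≤ L)
    (hL : ∀ x y : EuclideanSpace ℝ (Fin d), (∀ i, 0 ≤ x i) → (∀ i, 0 ≤ y i) →
      ‖hess f x - hess f y‖ ≤ L * ‖x - y‖)
    {x y : EuclideanSpace ℝ (Fin d)} (hx : ∀ i, 0 ≤ x i) (hy : ∀ i, 0 ≤ y i) :
    ‖gradient f y - gradient f x - hess f x (y - x)‖ ≤ L * ‖y - x‖ ^ 2 := by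
  have key := (convex_orthant_inter_ball x ‖y - x‖).norm_image_sub_le_of_norm_hasFDerivWithin_le
    (f := fun z => gradient f z - hess f x z)
    (f' := fun z => hess f z - hess f x) (C := L * ‖y - x‖)
    (fun z _ => ((hasFDerivAt_gradient hf z).sub (hess f x).hasFDerivAt).hasFDerivWithinAt)
    (fun z hz => by
      refine (hL z x hz.1 hx).trans ?_
      have := mem_closedBall_iff_norm.1 hz.2
      gcongr)
    ⟨hx, Metric.mem_closedBall_self (norm_nonneg _)⟩ ⟨hy, mem_closedBall_iff_norm.2 le_rfl⟩
  have e : gradient f y - gradient f x - hess f x (y - x) =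
      gradient f y - hess f x y - (gradient f x - hess f x x) := by
    rw [map_sub]; abel
  rw [e]
  refine key.trans_eq ?_
  ring

lemma taylor_second (hf : ContDiff ℝ 2 f) {L : ℝ} (hL0 : 0 ≤ L)
    (hL : ∀ x y : EuclideanSpace ℝ (Fin d), (∀ i, 0 ≤ x i) → (∀ i, 0 ≤ y i) →
      ‖hess f x - hess f y‖ ≤ L * ‖x - y‖)
    {x y : EuclideanSpace ℝ (Fin d)} (hx : ∀ i, 0 ≤ x i) (hy : ∀ i, 0 ≤ y i) :
    f y - f x ≤ inner ℝ (gradient f x) (y - x) + 1 / 2 * inner ℝ (y - x) (hess f x (y - x)) +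
      L * ‖y - x‖ ^ 3 := by
  have hquad : ∀ z, HasFDerivAt (fun z => (1 / 2 : ℝ) * inner ℝ (z - x) (hess f x (z - x)))
      (innerSL ℝ (hess f x (z - x))) z := by
    intro z
    have h1 : HasFDerivAt (fun z => z - x) (ContinuousLinearMap.id ℝ _) z :=
      (hasFDerivAt_id z).sub_const x
    have h2 : HasFDerivAt (fun z => hess f x (z - x)) (hess f x) z :=
      (hess f x).hasFDerivAt.comp z h1
    refine ((h1.inner ℝ h2).const_mul (1 / 2)).congr_fderiv ?_
    ext v
    simp only [smul_apply, ContinuousLinearMap.comp_apply,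
      ContinuousLinearMap.prod_apply, ContinuousLinearMap.id_apply, fderivInnerCLM_apply,
      innerSL_apply_apply, smul_eq_mul]
    rw [← inner_hess_comm hf, real_inner_comm (hess f x (z - x)) v]
    ring
  have key := (convex_orthant_inter_ball x ‖y - x‖).norm_image_sub_le_of_norm_hasFDerivWithin_le
    (f := fun z => f z - innerSL ℝ (gradient f x) z -
      (1 / 2 : ℝ) * inner ℝ (z - x) (hess f x (z - x)))
    (f' := fun z => innerSL ℝ (gradient f z) - innerSL ℝ (gradient f x) -
      innerSL ℝ (hess f x (z - x))) (C := L * ‖y - x‖ ^ 2)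
    (fun z _ => (((hasFDerivAt_innerSL_gradient hf z).sub
      (innerSL ℝ (gradient f x)).hasFDerivAt).sub (hquad z)).hasFDerivWithinAt)
    (fun z hz => by
      rw [← map_sub, ← map_sub, innerSL_apply_norm]
      refine (norm_gradient_sub_le hf hL0 hL hx hz.1).trans ?_
      have := mem_closedBall_iff_norm.1 hz.2
      gcongr)
    ⟨hx, Metric.mem_closedBall_self (norm_nonneg _)⟩ ⟨hy, mem_closedBall_iff_norm.2 le_rfl⟩
  have h1 := (le_abs_self _).trans key
  simp only [innerSL_apply_apply, sub_self, inner_zero_left, mul_zero, sub_zero] at h1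
  have e : L * ‖y - x‖ ^ 3 = L * ‖y - x‖ ^ 2 * ‖y - x‖ := by ring
  rw [inner_sub_right (gradient f x), e]
  linarith

end Calculus

/-! ### Subvectors and principal submatrices -/

section Subvectors

variable {d : ℕ} {f : EuclideanSpace ℝ (Fin d) → ℝ}

@[simp] lemma subvec_apply (I : Finset (Fin d)) (v : EuclideanSpace ℝ (Fin d)) (i : I) :
    subvec I v i = v i := rfl

/-- Extension of a subvector by zero. -/
noncomputable def extendZero (I : Finset (Fin d)) (v : EuclideanSpace ℝ I) :
    EuclideanSpace ℝ (Fin d) :=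
  WithLp.toLp 2 fun i => if h : i ∈ I then v ⟨i, h⟩ else 0

lemma extendZero_apply (I : Finset (Fin d)) (v : EuclideanSpace ℝ I) (i : Fin d) :
    extendZero I v i = if h : i ∈ I then v ⟨i, h⟩ else 0 := rfl

lemma subvec_extendZero (I : Finset (Fin d)) (v : EuclideanSpace ℝ I) :
    subvec I (extendZero I v) = v := by
  ext i
  simp [extendZero_apply]

lemma inner_subvec (I : Finset (Fin d)) (v w : EuclideanSpace ℝ (Fin d)) :
    inner ℝ (subvec I v) (subvec I w) = ∑ i ∈ I, v i * w i := by
  rw [PiLp.inner_apply, ← Finset.sum_coe_sort I]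
  exact Finset.sum_congr rfl fun i _ => by simp [mul_comm]

lemma inner_eq_sum (v w : EuclideanSpace ℝ (Fin d)) : inner ℝ v w = ∑ i, v i * w i := by
  rw [PiLp.inner_apply]
  exact Finset.sum_congr rfl fun i _ => by simp [mul_comm]

lemma norm_sq_subvec (I : Finset (Fin d)) (v : EuclideanSpace ℝ (Fin d)) :
    ‖subvec I v‖ ^ 2 = ∑ i ∈ I, v i ^ 2 := by
  rw [← real_inner_self_eq_norm_sq, inner_subvec]
  exact Finset.sum_congr rfl fun i _ => by ring

lemma norm_sq_eq_sum (v : EuclideanSpace ℝ (Fin d)) : ‖v‖ ^ 2 = ∑ i, v i ^ 2 := by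
  rw [← real_inner_self_eq_norm_sq, inner_eq_sum]
  exact Finset.sum_congr rfl fun i _ => by ring

lemma norm_subvec_le (I : Finset (Fin d)) (v : EuclideanSpace ℝ (Fin d)) :
    ‖subvec I v‖ ≤ ‖v‖ := by
  refine le_of_sq_le_sq ?_ (norm_nonneg _)
  rw [norm_sq_subvec, norm_sq_eq_sum]
  exact Finset.sum_le_sum_of_subset_of_nonneg (Finset.subset_univ I) fun i _ _ => sq_nonneg _

lemma norm_subvec_mono {I J : Finset (Fin d)} (h : I ⊆ J) (v : EuclideanSpace ℝ (Fin d)) :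
    ‖subvec I v‖ ≤ ‖subvec J v‖ := by
  refine le_of_sq_le_sq ?_ (norm_nonneg _)
  rw [norm_sq_subvec, norm_sq_subvec]
  exact Finset.sum_le_sum_of_subset_of_nonneg h fun i _ _ => sq_nonneg _

lemma inner_extendZero (I : Finset (Fin d)) (v : EuclideanSpace ℝ I)
    (w : EuclideanSpace ℝ (Fin d)) : inner ℝ (extendZero I v) w = inner ℝ v (subvec I w) := by
  conv_rhs => rw [← subvec_extendZero I v]
  rw [inner_subvec, inner_eq_sum]
  refine (Finset.sum_subset (Finset.subset_univ I) fun i _ hi => ?_).symm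
  rw [extendZero_apply, dif_neg hi, zero_mul]

lemma norm_extendZero (I : Finset (Fin d)) (v : EuclideanSpace ℝ I) :
    ‖extendZero I v‖ = ‖v‖ := by
  rw [← sq_eq_sq₀ (norm_nonneg _) (norm_nonneg _), ← real_inner_self_eq_norm_sq,
    inner_extendZero, subvec_extendZero, real_inner_self_eq_norm_sq]

/-- The principal submatrix of the Hessian is the compression of the Hessian. -/
lemma subHess_apply (I : Finset (Fin d)) (x : EuclideanSpace ℝ (Fin d)) (v : EuclideanSpace ℝ I) :
    subHess f I x v = subvec I (hess f x (extendZero I v)) := by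
  have hsum : extendZero I v = ∑ j : I, v j • EuclideanSpace.single (j : Fin d) (1 : ℝ) := by
    ext i
    rw [extendZero_apply]
    simp only [WithLp.ofLp_sum, WithLp.ofLp_smul, Finset.sum_apply, Pi.smul_apply, smul_eq_mul,
      PiLp.single_apply, mul_ite, mul_one, mul_zero]
    split_ifs with h
    · rw [Finset.sum_eq_single ⟨i, h⟩]
      · simp
      · intro j _ hj
        rw [if_neg]
        rintro rfl
        exact hj rfl
      · simp
    · refine (Finset.sum_eq_zero fun j _ => ?_).symm
      rw [if_neg]
      rintro rfl
      exact h j.2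
  ext i
  rw [hsum, map_sum, subvec_apply]
  simp only [map_smul, WithLp.ofLp_sum, WithLp.ofLp_smul, Finset.sum_apply, Pi.smul_apply,
    smul_eq_mul]
  rw [subHess, Matrix.toLpLin_apply]
  simp only [Matrix.mulVec, dotProduct, Matrix.submatrix_apply, hessMatrix, Matrix.of_apply]
  exact Finset.sum_congr rfl fun j _ => mul_comm _ _

lemma inner_subHess (I : Finset (Fin d)) (x : EuclideanSpace ℝ (Fin d)) (v w : EuclideanSpace ℝ I) :
    inner ℝ v (subHess f I x w) = inner ℝ (extendZero I v) (hess f x (extendZero I w)) := by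
  rw [subHess_apply, inner_extendZero]

lemma isSymmetric_subHess (hf : ContDiff ℝ 2 f) (I : Finset (Fin d))
    (x : EuclideanSpace ℝ (Fin d)) : (subHess f I x).IsSymmetric := fun v w => by
  rw [inner_subHess, real_inner_comm, inner_subHess, real_inner_comm, inner_hess_comm hf]

lemma norm_subHess_le {L : ℝ} {I : Finset (Fin d)} {x : EuclideanSpace ℝ (Fin d)}
    (hL : ‖hess f x‖ ≤ L) (v : EuclideanSpace ℝ I) : ‖subHess f I x v‖ ≤ L * ‖v‖ := by
  rw [subHess_apply, ← norm_extendZero I v]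
  exact (norm_subvec_le _ _).trans ((hess f x).le_of_opNorm_le hL _)

end Subvectors

/-! ### Step size tracking -/

section Tracking

variable {crit : ℝ → Prop} {ζ a : ℝ}

lemma BackTracking.spec (hζ : 0 < ζ) (hζ' : ζ < 1) (h : BackTracking crit ζ a) :
    0 < a ∧ a ≤ 1 ∧ crit a ∧ (a = 1 ∨ a / ζ ≤ 1 ∧ ¬ crit (a / ζ)) := by
  obtain ⟨n, h1, h2, rfl⟩ := h
  refine ⟨pow_pos hζ n, pow_le_one₀ hζ.le hζ'.le, h2, ?_⟩
  cases n with
  | zero => exact Or.inl (pow_zero ζ)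
  | succ n =>
    rw [pow_succ, mul_div_cancel_right₀ _ hζ.ne']
    exact Or.inr ⟨pow_le_one₀ hζ.le hζ'.le, h1 n n.lt_succ_self⟩

lemma ForwardTracking.spec (hζ : 0 < ζ) (hζ' : ζ < 1) (h : ForwardTracking crit ζ a) :
    0 < a ∧ crit a ∧ ¬ crit (a / ζ) := by
  rcases h with ⟨h1, hb⟩ | ⟨n, h1, h2, rfl⟩
  · obtain ⟨h2, -, h3, rfl | h4⟩ := hb.spec hζ hζ'
    · exact absurd h3 h1
    · exact ⟨h2, h3, h4.2⟩
  · refine ⟨by positivity, h1 n le_rfl, ?_⟩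
    rwa [div_eq_mul_inv, ← pow_succ]

lemma exists_backTracking (hζ : 0 < ζ) (hζ' : ζ < 1) {a₀ : ℝ} (ha₀ : 0 < a₀)
    (hcrit : ∀ a, 0 < a → a ≤ a₀ → crit a) : ∃ a, BackTracking crit ζ a := by
  classical
  have hex : ∃ n : ℕ, crit (ζ ^ n) := by
    obtain ⟨n, hn⟩ := exists_pow_lt_of_lt_one ha₀ hζ'
    exact ⟨n, hcrit _ (pow_pos hζ n) hn.le⟩
  exact ⟨_, Nat.find hex, fun j hj => Nat.find_min hex hj, Nat.find_spec hex, rfl⟩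

lemma exists_forwardTracking (hζ : 0 < ζ) (hζ' : ζ < 1) {a₀ a₁ : ℝ} (ha₀ : 0 < a₀)
    (hcrit : ∀ a, 0 < a → a ≤ a₀ → crit a) (hfail : ∀ a, a₁ < a → ¬ crit a) :
    ∃ a, ForwardTracking crit ζ a := by
  classical
  by_cases h1 : crit 1
  · have hex : ∃ n : ℕ, ¬ crit (ζ⁻¹ ^ (n + 1)) := by
      obtain ⟨n, hn⟩ := pow_unbounded_of_one_lt a₁ ((one_lt_inv₀ hζ).2 hζ')
      refine ⟨n, hfail _ (hn.trans_le ?_)⟩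
      exact pow_le_pow_right₀ ((one_le_inv₀ hζ).2 hζ'.le) n.le_succ
    refine ⟨_, Or.inr ⟨Nat.find hex, fun j hj => ?_, Nat.find_spec hex, rfl⟩⟩
    cases j with
    | zero => rwa [pow_zero]
    | succ j => exact not_not.1 (Nat.find_min hex hj)
  · obtain ⟨a, ha⟩ := exists_backTracking hζ hζ' ha₀ hcrit
    exact ⟨a, Or.inl ⟨h1, ha⟩⟩

end Tracking

/-! ### The projected step -/

section Projection

variable {d : ℕ} {f : EuclideanSpace ℝ (Fin d) → ℝ} {x p : EuclideanSpace ℝ (Fin d)} {δ a : ℝ}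

lemma proj_apply (x : EuclideanSpace ℝ (Fin d)) (i : Fin d) : proj x i = max (x i) 0 := rfl

lemma proj_nonneg (x : EuclideanSpace ℝ (Fin d)) (i : Fin d) : 0 ≤ proj x i :=
  le_max_right _ _

lemma mem_active (i : Fin d) : i ∈ active x δ ↔ 0 ≤ x i ∧ x i ≤ δ := by simp [active]

lemma mem_inactive (i : Fin d) : i ∈ inactive x δ ↔ δ < x i := by simp [inactive]

lemma inactive_eq_compl (hx : ∀ i, 0 ≤ x i) : inactive x δ = (active x δ)ᶜ := by
  ext i
  simp [mem_active, mem_inactive, hx i]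

lemma inner_eq_add (hx : ∀ i, 0 ≤ x i) (δ : ℝ) (v w : EuclideanSpace ℝ (Fin d)) :
    inner ℝ v w = inner ℝ (subvec (active x δ) v) (subvec (active x δ) w) +
      inner ℝ (subvec (inactive x δ) v) (subvec (inactive x δ) w) := by
  rw [inner_eq_sum, inner_subvec, inner_subvec, inactive_eq_compl hx, Finset.sum_add_sum_compl]

lemma norm_sq_eq_add (hx : ∀ i, 0 ≤ x i) (δ : ℝ) (v : EuclideanSpace ℝ (Fin d)) :
    ‖v‖ ^ 2 = ‖subvec (active x δ) v‖ ^ 2 + ‖subvec (inactive x δ) v‖ ^ 2 := by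
  rw [← real_inner_self_eq_norm_sq, inner_eq_add hx δ, real_inner_self_eq_norm_sq,
    real_inner_self_eq_norm_sq]

/-- Steps that keep the inactive coordinates positive are not cut off by the projection. -/
lemma subvec_inactive_proj_sub (ha : 0 ≤ a)
    (h : a * ‖subvec (inactive x δ) p‖ ≤ δ) :
    subvec (inactive x δ) (proj (x + a • p) - x) = a • subvec (inactive x δ) p := by
  ext ⟨i, hi⟩
  have h1 : |p i| ≤ ‖subvec (inactive x δ) p‖ := by
    simpa using PiLp.norm_apply_le (subvec (inactive x δ) p) ⟨i, hi⟩
  have h2 : a * |p i| ≤ δ := (mul_le_mul_of_nonneg_left h1 ha).trans h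
  have h3 : 0 ≤ x i + a * p i := by
    have := mul_le_mul_of_nonneg_left (neg_abs_le (p i)) ha
    have := (mem_inactive i).1 hi
    linarith
  simp [proj_apply, max_eq_left h3]

lemma proj_sub_eq_extendZero (ha : 0 ≤ a) (hx : ∀ i, 0 ≤ x i) (hp : ∀ i ∈ active x δ, p i = 0)
    (h : a * ‖subvec (inactive x δ) p‖ ≤ δ) :
    proj (x + a • p) - x = a • extendZero (inactive x δ) (subvec (inactive x δ) p) := by
  have h0 := subvec_inactive_proj_sub ha h
  ext i
  by_cases hi : i ∈ inactive x δ
  · have := congrArg (fun v => v ⟨i, hi⟩) h0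
    simp only [subvec_apply] at this
    rw [this]
    simp [extendZero_apply, hi]
  · have hi' : i ∈ active x δ := by rwa [inactive_eq_compl hx, Finset.mem_compl, not_not] at hi
    simp [extendZero_apply, hi, proj_apply, hp i hi', hx i]

/-- The projected gradient step decreases the linear model coordinatewise. -/
lemma sq_proj_sub_le {g : ℝ} {i : Fin d} (hx : 0 ≤ x i)
    (hp : p i = -g ∨ p i = 0) :
    (proj (x + a • p) i - x i) ^ 2 ≤ -(a * (g * (proj (x + a • p) i - x i))) := by
  have e : proj (x + a • p) i = max (x i + a * p i) 0 := by simp [proj_apply]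
  rw [e]
  rcases hp with hp | hp <;> rw [hp]
  · rcases le_total 0 (x i + a * -g) with h | h
    · rw [max_eq_left h]; apply le_of_eq; ring
    · rw [max_eq_right h]
      have : x i * x i ≤ x i * (a * g) := mul_le_mul_of_nonneg_left (by linarith) hx
      linarith
  · rw [mul_zero, add_zero, max_eq_left hx, sub_self]; simp

lemma norm_sq_active_le (hx : ∀ i, 0 ≤ x i) {g : EuclideanSpace ℝ (Fin d)}
    (hp : ∀ i ∈ active x δ, p i = -g i ∨ p i = 0) :
    ‖subvec (active x δ) (proj (x + a • p) - x)‖ ^ 2 ≤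
      -(a * inner ℝ (subvec (active x δ) g) (subvec (active x δ) (proj (x + a • p) - x))) := by
  rw [norm_sq_subvec, inner_subvec, Finset.mul_sum, ← Finset.sum_neg_distrib]
  exact Finset.sum_le_sum fun i hi => sq_proj_sub_le (hx i) (hp i hi)

lemma inner_active_nonpos (ha : 0 < a) (hx : ∀ i, 0 ≤ x i) {g : EuclideanSpace ℝ (Fin d)}
    (hp : ∀ i ∈ active x δ, p i = -g i ∨ p i = 0) :
    inner ℝ (subvec (active x δ) g) (subvec (active x δ) (proj (x + a • p) - x)) ≤ 0 := by
  have h1 := (sq_nonneg _).trans (norm_sq_active_le (a := a) hx hp)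
  by_contra h2
  have := mul_pos ha (not_le.1 h2)
  linarith

end Projection

/-! ### Acceptance of short steps -/

/-- The regularity of the objective on the nonnegative orthant. -/
structure SmoothOnOrthant {d : ℕ} (f : EuclideanSpace ℝ (Fin d) → ℝ) (Lg LH : ℝ) : Prop where
  contDiff : ContDiff ℝ 2 f
  Lg_nonneg : 0 ≤ Lg
  LH_nonneg : 0 ≤ LH
  gradient_lipschitz : ∀ x y : EuclideanSpace ℝ (Fin d), (∀ i, 0 ≤ x i) → (∀ i, 0 ≤ y i) →
    ‖gradient f x - gradient f y‖ ≤ Lg * ‖x - y‖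
  hess_lipschitz : ∀ x y : EuclideanSpace ℝ (Fin d), (∀ i, 0 ≤ x i) → (∀ i, 0 ≤ y i) →
    ‖hess f x - hess f y‖ ≤ LH * ‖x - y‖

section LineSearch

variable {d : ℕ} {f : EuclideanSpace ℝ (Fin d) → ℝ} {Lg LH : ℝ}
  {x p : EuclideanSpace ℝ (Fin d)} {δ a ρ μ : ℝ}

/-- First-order acceptance: the criterion holds for steps below a constant that keep the inactive
coordinates positive. -/
lemma lineSearchCriterion_of_first_order (hf : SmoothOnOrthant f Lg LH) (hρ : ρ < 1)
    (hx : ∀ i, 0 ≤ x i)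
    (hp : ∀ i ∈ active x δ, p i = -gradient f x i ∨ p i = 0) (hμ : μ ≤ 1)
    (hdesc : inner ℝ (subvec (inactive x δ) (gradient f x)) (subvec (inactive x δ) p) ≤
      -(μ * ‖subvec (inactive x δ) p‖ ^ 2))
    (ha : 0 < a) (haδ : a * ‖subvec (inactive x δ) p‖ ≤ δ) (haL : a * Lg ≤ (1 - ρ) * μ) :
    LineSearchCriterion f ρ δ x p a := by
  have h1 := taylor_first hf.contDiff hf.Lg_nonneg hf.gradient_lipschitz hx
    (proj_nonneg (x + a • p))
  rw [inner_eq_add hx δ, norm_sq_eq_add hx δ, subvec_inactive_proj_sub ha.le haδ, norm_smul,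
    mul_pow, Real.norm_eq_abs, sq_abs, real_inner_smul_right] at h1
  have h2 := norm_sq_active_le (a := a) hx hp
  have h3 := inner_active_nonpos ha hx hp
  rw [LineSearchCriterion]
  set A := inner ℝ (subvec (active x δ) (gradient f x))
    (subvec (active x δ) (proj (x + a • p) - x))
  set B := inner ℝ (subvec (inactive x δ) (gradient f x)) (subvec (inactive x δ) p)
  set N := ‖subvec (active x δ) (proj (x + a • p) - x)‖ ^ 2
  set P := ‖subvec (inactive x δ) p‖ ^ 2
  have hP : 0 ≤ P := sq_nonneg _
  have h4 : Lg * N ≤ Lg * -(a * A) := mul_le_mul_of_nonneg_left h2 hf.Lg_nonneg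
  have h5 : 0 ≤ (1 - ρ - a * Lg) * -A := by
    refine mul_nonneg ?_ (by linarith)
    have : (1 - ρ) * μ ≤ (1 - ρ) * 1 := mul_le_mul_of_nonneg_left hμ (by linarith)
    linarith
  have h6 : 0 ≤ a * (1 - ρ) * (-B - μ * P) :=
    mul_nonneg (mul_nonneg ha.le (by linarith)) (by linarith)
  have h7 : 0 ≤ a * P * ((1 - ρ) * μ - a * Lg) :=
    mul_nonneg (mul_nonneg ha.le hP) (by linarith)
  linarith

/-- Second-order acceptance for directions supported on the inactive coordinates. -/
lemma lineSearchCriterion_of_second_order (hf : SmoothOnOrthant f Lg LH)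
    (hx : ∀ i, 0 ≤ x i) (hρ : ρ ≤ 1 / 2)
    (hp : ∀ i ∈ active x δ, p i = 0)
    (hdesc : inner ℝ (subvec (inactive x δ) (gradient f x)) (subvec (inactive x δ) p) ≤
      -(μ * ‖subvec (inactive x δ) p‖ ^ 2))
    (ha : 0 < a) (haδ : a * ‖subvec (inactive x δ) p‖ ≤ δ)
    (hcurv : a * inner ℝ (subvec (inactive x δ) p)
        (subHess f (inactive x δ) x (subvec (inactive x δ) p)) ≤
      -inner ℝ (subvec (inactive x δ) (gradient f x)) (subvec (inactive x δ) p))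
    (haL : LH * (a ^ 2 * ‖subvec (inactive x δ) p‖) ≤ (1 / 2 - ρ) * μ) :
    LineSearchCriterion f ρ δ x p a := by
  have hstep := proj_sub_eq_extendZero ha.le hx hp haδ
  have h1 := taylor_second hf.contDiff hf.LH_nonneg hf.hess_lipschitz hx
    (proj_nonneg (x + a • p))
  have hA : inner ℝ (subvec (active x δ) (gradient f x))
      (subvec (active x δ) (proj (x + a • p) - x)) = 0 := by
    rw [inner_subvec]
    exact Finset.sum_eq_zero fun i hi => by simp [proj_apply, hp i hi, hx i]
  rw [LineSearchCriterion, hA]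
  rw [hstep, real_inner_smul_right, real_inner_comm, inner_extendZero, map_smul,
    real_inner_smul_left, real_inner_smul_right, ← inner_subHess, norm_smul, norm_extendZero,
    Real.norm_eq_abs, abs_of_pos ha, real_inner_comm] at h1
  set B := inner ℝ (subvec (inactive x δ) (gradient f x)) (subvec (inactive x δ) p)
  set Q := inner ℝ (subvec (inactive x δ) p)
        (subHess f (inactive x δ) x (subvec (inactive x δ) p))
  set P := ‖subvec (inactive x δ) p‖
  have h2 : 0 ≤ a * (-B - a * Q) := mul_nonneg ha.le (by linarith)
  have h3 : 0 ≤ a * (1 / 2 - ρ) * (-B - μ * P ^ 2) :=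
    mul_nonneg (mul_nonneg ha.le (by linarith)) (by linarith)
  have h4 : 0 ≤ a * P ^ 2 * ((1 / 2 - ρ) * μ - LH * (a ^ 2 * P)) :=
    mul_nonneg (by positivity) (by linarith)
  nlinarith

end LineSearch

/-! ### Decrease through the active coordinates -/

section Active

variable {d : ℕ} {f : EuclideanSpace ℝ (Fin d) → ℝ} {ε ζ : ℝ}
  {x p : EuclideanSpace ℝ (Fin d)} {a : ℝ}

/-- If one of the two conditions on the active set fails, the projected gradient step on the active
coordinates decreases the linear model by a multiple of `ε`. -/
lemma inner_active_le_of_typeI (hε : 0 < ε) (hx : ∀ i, 0 ≤ x i) (hI : TypeI f ε x)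
    (hp : ∀ i ∈ active x (√ε), p i = -gradient f x i) (ha : 0 < a) :
    min 1 a * ε ≤ -inner ℝ (subvec (active x (√ε)) (gradient f x))
      (subvec (active x (√ε)) (proj (x + a • p) - x)) := by
  set g := gradient f x with hg
  set T : Fin d → ℝ := fun i => -(g i * (proj (x + a • p) i - x i)) with hT
  have hsum : -inner ℝ (subvec (active x (√ε)) g) (subvec (active x (√ε)) (proj (x + a • p) - x)) =
      ∑ i ∈ active x (√ε), T i := by
    rw [inner_subvec, ← Finset.sum_neg_distrib]; rfl
  have hmin0 : 0 ≤ min 1 a := le_min zero_le_one ha.le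
  have hT0 : ∀ i ∈ active x (√ε), 0 ≤ T i := fun i hi => by
    have h1 := (sq_nonneg _).trans (sq_proj_sub_le (a := a) (hx i) (Or.inl (hp i hi)))
    rw [← mul_neg] at h1
    exact nonneg_of_mul_nonneg_right h1 ha
  have hT1 : ∀ i ∈ active x (√ε), 0 ≤ x i - a * g i → T i = a * g i ^ 2 := fun i hi h => by
    have e : proj (x + a • p) i = max (x i + a * p i) 0 := by simp [proj_apply]
    rw [hT]
    simp only [e]
    rw [hp i hi, max_eq_left (by linarith)]
    ring
  have hT2 : ∀ i ∈ active x (√ε), x i - a * g i ≤ 0 → T i = g i * x i := fun i hi h => by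
    have e : proj (x + a • p) i = max (x i + a * p i) 0 := by simp [proj_apply]
    rw [hT]
    simp only [e]
    rw [hp i hi, max_eq_right (by linarith)]
    ring
  have hsingle : ∀ i ∈ active x (√ε), min 1 a * ε ≤ T i →
      min 1 a * ε ≤ ∑ i ∈ active x (√ε), T i := fun i hi h =>
    h.trans (Finset.single_le_sum hT0 hi)
  rw [hsum]
  rcases hI.2 with h | h
  · simp only [ActiveSign, not_forall, not_le] at h
    obtain ⟨i, hi, hgi⟩ := h
    refine hsingle i hi ?_
    have hs := Real.sqrt_nonneg ε
    have hg2 : ε ≤ g i ^ 2 := by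
      rw [← Real.sq_sqrt hε.le, ← neg_sq (g i)]
      exact pow_le_pow_left₀ hs (by linarith) 2
    have h1 : a * g i ≤ 0 := mul_nonpos_of_nonneg_of_nonpos ha.le (by linarith)
    rw [hT1 i hi (by linarith [hx i])]
    exact mul_le_mul (min_le_right _ _) hg2 hε.le ha.le
  · by_cases hbig : ∃ i ∈ active x (√ε), ε ≤ T i
    · obtain ⟨i, hi, hTi⟩ := hbig
      exact hsingle i hi ((mul_le_of_le_one_left hε.le (min_le_left _ _)).trans hTi)
    · push Not at hbig
      have hterm : ∀ i ∈ active x (√ε), min 1 a * (x i * g i) ^ 2 ≤ ε * T i := by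
        intro i hi
        have hxi : x i ^ 2 ≤ ε := by
          rw [← Real.sq_sqrt hε.le]
          exact pow_le_pow_left₀ (hx i) ((mem_active i).1 hi).2 2
        rcases le_total 0 (x i - a * g i) with h1 | h1
        · rw [hT1 i hi h1, mul_pow]
          calc min 1 a * (x i ^ 2 * g i ^ 2) ≤ a * (ε * g i ^ 2) := by
                gcongr
                exact min_le_right _ _
            _ = ε * (a * g i ^ 2) := by ring
        · have h2 := hbig i hi
          have h3 := hT0 i hi
          rw [hT2 i hi h1] at h2 h3 ⊢
          calc min 1 a * (x i * g i) ^ 2 ≤ 1 * (x i * g i) ^ 2 := by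
                gcongr
                exact min_le_left _ _
            _ = (g i * x i) * (g i * x i) := by ring
            _ ≤ ε * (g i * x i) := by gcongr
      have hnorm : ε ^ 2 < ∑ i ∈ active x (√ε), (x i * g i) ^ 2 := by
        rw [ActiveCompl, not_le] at h
        have := pow_lt_pow_left₀ h hε.le (two_ne_zero)
        rwa [norm_sq_subvec] at this
      have h1 : min 1 a * ε ^ 2 ≤ ε * ∑ i ∈ active x (√ε), T i := by
        calc min 1 a * ε ^ 2 ≤ min 1 a * ∑ i ∈ active x (√ε), (x i * g i) ^ 2 := by gcongr
          _ ≤ ε * ∑ i ∈ active x (√ε), T i := by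
            rw [Finset.mul_sum, Finset.mul_sum]
            exact Finset.sum_le_sum hterm
      refine le_of_mul_le_mul_left ?_ hε
      linarith

end Active

/-! ### MINRES directions along the algorithm -/

section Directions

variable {d : ℕ} {f : EuclideanSpace ℝ (Fin d) → ℝ} {Lg LH σ ρ θ ζ ε : ℝ}
  {x₀ x : EuclideanSpace ℝ (Fin d)} {t : ℕ} {p : EuclideanSpace ℝ (inactive x (√ε))} {D : DType}

lemma MinresCall.sol (hf : SmoothOnOrthant f Lg LH) (hθ : 0 < θ)
    (hK : KrylovRegularity f ρ θ ζ ε x₀ σ) (hact : IsActiveIterate f ρ θ ζ ε x₀ x)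
    (h : MinresCall f θ ε x t p DType.SOL) :
    inner ℝ p (subHess f (inactive x (√ε)) x p) ≤
        -inner ℝ (subvec (inactive x (√ε)) (gradient f x)) p ∧
      σ * ‖p‖ ^ 2 ≤ inner ℝ p (subHess f (inactive x (√ε)) x p) ∧
      σ * ‖subHess f (inactive x (√ε)) x p + subvec (inactive x (√ε)) (gradient f x)‖ ≤
        θ * √ε * ‖subHess f (inactive x (√ε)) x p‖ :=
  MinresReturns.sol (isSymmetric_subHess hf.contDiff _ _) (by positivity) h fun _ hu =>
    curvature_ge_of_posSemidef (isSymmetric_subHess hf.contDiff _ _) (hK x hact t p h) hu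

/-- Both kinds of directions descend at a rate proportional to their squared length. -/
lemma MinresCall.descent (hf : SmoothOnOrthant f Lg LH) (hθ : 0 < θ)
    (hK : KrylovRegularity f ρ θ ζ ε x₀ σ) (hact : IsActiveIterate f ρ θ ζ ε x₀ x)
    (h : MinresCall f θ ε x t p D) :
    inner ℝ (subvec (inactive x (√ε)) (gradient f x)) p ≤ -(min 1 σ * ‖p‖ ^ 2) := by
  have hp := sq_nonneg ‖p‖
  cases D with
  | NPC =>
    rw [(MinresReturns.npc h).2.1]
    have := mul_le_mul_of_nonneg_right (min_le_left 1 σ) hp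
    linarith
  | SOL =>
    obtain ⟨h1, h2, -⟩ := MinresCall.sol hf hθ hK hact h
    have := mul_le_mul_of_nonneg_right (min_le_right 1 σ) hp
    linarith

lemma MinresCall.curvature (hf : SmoothOnOrthant f Lg LH) (hθ : 0 < θ) (hσ : 0 < σ)
    (hK : KrylovRegularity f ρ θ ζ ε x₀ σ) (hact : IsActiveIterate f ρ θ ζ ε x₀ x)
    (h : MinresCall f θ ε x t p D) {a : ℝ} (ha : 0 < a) (haD : D = DType.NPC ∨ a ≤ 1) :
    a * inner ℝ p (subHess f (inactive x (√ε)) x p) ≤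
      -inner ℝ (subvec (inactive x (√ε)) (gradient f x)) p := by
  cases D with
  | NPC =>
    obtain ⟨h1, h2, -⟩ := MinresReturns.npc h
    rw [h2, neg_neg]
    exact (mul_nonpos_of_nonneg_of_nonpos ha.le h1).trans (sq_nonneg _)
  | SOL =>
    obtain ⟨h1, h2, -⟩ := MinresCall.sol hf hθ hK hact h
    have h3 : 0 ≤ inner ℝ p (subHess f (inactive x (√ε)) x p) := le_trans (by positivity) h2
    exact (mul_le_of_le_one_left h3 (haD.resolve_left (by simp))).trans h1

lemma MinresCall.norm_residual_le (hf : SmoothOnOrthant f Lg LH) (hθ : 0 < θ) (hσ : 0 < σ)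
    (hx : ∀ i, 0 ≤ x i)
    (hK : KrylovRegularity f ρ θ ζ ε x₀ σ) (hact : IsActiveIterate f ρ θ ζ ε x₀ x)
    (h : MinresCall f θ ε x t p DType.SOL) :
    ‖subHess f (inactive x (√ε)) x p + subvec (inactive x (√ε)) (gradient f x)‖ ≤
      θ * Lg / σ * √ε * ‖p‖ := by
  obtain ⟨-, -, h3⟩ := MinresCall.sol hf hθ hK hact h
  have h4 := norm_subHess_le (I := inactive x (√ε))
    (norm_hess_le hf.contDiff hf.Lg_nonneg hf.gradient_lipschitz hx) p
  have h5 : θ * √ε * ‖subHess f (inactive x (√ε)) x p‖ ≤ θ * √ε * (Lg * ‖p‖) := by gcongr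
  have e : θ * Lg / σ * √ε * ‖p‖ = θ * √ε * (Lg * ‖p‖) / σ := by ring
  rw [e, le_div_iff₀ hσ, mul_comm]
  exact h3.trans h5

lemma MinresCall.norm_gradient_le (hf : SmoothOnOrthant f Lg LH) (hθ : 0 < θ) (hσ : 0 < σ)
    (hx : ∀ i, 0 ≤ x i) (hε1 : ε < 1)
    (hK : KrylovRegularity f ρ θ ζ ε x₀ σ) (hact : IsActiveIterate f ρ θ ζ ε x₀ x)
    (h : MinresCall f θ ε x t p DType.SOL) :
    ‖subvec (inactive x (√ε)) (gradient f x)‖ ≤ (Lg + θ * Lg / σ + 1) * ‖p‖ := by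
  have h1 := MinresCall.norm_residual_le hf hθ hσ hx hK hact h
  have h4 := norm_subHess_le (I := inactive x (√ε))
    (norm_hess_le hf.contDiff hf.Lg_nonneg hf.gradient_lipschitz hx) p
  have h2 : subvec (inactive x (√ε)) (gradient f x) =
      (subHess f (inactive x (√ε)) x p + subvec (inactive x (√ε)) (gradient f x)) -
        subHess f (inactive x (√ε)) x p := by abel
  have h3 : √ε ≤ 1 := Real.sqrt_le_one.2 hε1.le
  have hLg := hf.Lg_nonneg
  have h5 : θ * Lg / σ * √ε * ‖p‖ ≤ θ * Lg / σ * 1 * ‖p‖ := by gcongr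
  have h6 := norm_nonneg p
  rw [h2]
  refine (norm_sub_le _ _).trans ?_
  linarith

end Directions

/-! ### Decrease per step -/

section StepSize

/-- A tracked step size is accepted, and the next larger trial is not, unless it is the first. -/
lemma stepSize_spec {crit : ℝ → Prop} {ζ a : ℝ} {D : DType} (hζ : 0 < ζ) (hζ' : ζ < 1)
    (h : match D with
      | DType.SOL => BackTracking crit ζ a
      | DType.NPC => ForwardTracking crit ζ a) :
    0 < a ∧ crit a ∧
      (D = DType.SOL ∧ a = 1 ∨ (D = DType.NPC ∨ a / ζ ≤ 1) ∧ ¬ crit (a / ζ)) := by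
  cases D with
  | SOL =>
    obtain ⟨h1, -, h2, h3⟩ := BackTracking.spec hζ hζ' h
    exact ⟨h1, h2, h3.imp (fun h => ⟨rfl, h⟩) fun h => ⟨Or.inr h.1, h.2⟩⟩
  | NPC =>
    obtain ⟨h1, h2, h3⟩ := ForwardTracking.spec hζ hζ' h
    exact ⟨h1, h2, Or.inr ⟨Or.inl rfl, h3⟩⟩

variable {d : ℕ} {f : EuclideanSpace ℝ (Fin d) → ℝ} {Lg LH σ ω ρ θ ζ ε : ℝ}
  {x₀ x p : EuclideanSpace ℝ (Fin d)} {t : ℕ} {D : DType} {a : ℝ}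

/-- A Type I step decreases `f` by a multiple of `ε`: a step size bounded away from zero pays
through the active coordinates, and a shorter one is caused by a long inactive direction, which pays
itself. -/
lemma decrease_typeI (hf : SmoothOnOrthant f Lg LH) (hσ : 0 < σ) (hρ : 0 < ρ) (hρ' : ρ < 1)
    (hθ : 0 < θ) (hζ : 0 < ζ) (hε : 0 < ε) (hx : ∀ i, 0 ≤ x i)
    (hK : KrylovRegularity f ρ θ ζ ε x₀ σ) (hact : IsActiveIterate f ρ θ ζ ε x₀ x)
    (hI : TypeI f ε x) (hp : ∀ i ∈ active x (√ε), p i = -gradient f x i)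
    (hcall : MinresCall f θ ε x t (subvec (inactive x (√ε)) p) D)
    (ha : 0 < a) (hcrit : LineSearchCriterion f ρ (√ε) x p a)
    (hnext : a = 1 ∨ ¬ LineSearchCriterion f ρ (√ε) x p (a / ζ)) :
    ρ * min (min 1 (ζ * ((1 - ρ) * min 1 σ / (Lg + 1)))) (min 1 σ * ζ ^ 2) * ε ≤
      f x - f (proj (x + a • p)) := by
  have hLg := hf.Lg_nonneg
  set μ := min 1 σ with hμ
  have hμ0 : 0 < μ := lt_min one_pos hσ
  have hμ1 : μ ≤ 1 := min_le_left _ _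
  set c₀ := (1 - ρ) * μ / (Lg + 1) with hc₀
  have hρ1 : 0 < 1 - ρ := by linarith
  have hc₀0 : 0 < c₀ := by positivity
  have hdesc := MinresCall.descent hf hθ hK hact hcall
  have hA := inner_active_le_of_typeI hε hx hI hp ha
  rw [LineSearchCriterion] at hcrit
  set P := ‖subvec (inactive x (√ε)) p‖ with hP
  set B := inner ℝ (subvec (inactive x (√ε)) (gradient f x)) (subvec (inactive x (√ε)) p)
  set A := inner ℝ (subvec (active x (√ε)) (gradient f x))
    (subvec (active x (√ε)) (proj (x + a • p) - x))
  have hmin0 : 0 ≤ min 1 a * ε := mul_nonneg (le_min zero_le_one ha.le) hε.le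
  have hdecr : ρ * (min 1 a * ε) + ρ * (μ * (a * P ^ 2)) ≤ f x - f (proj (x + a • p)) := by
    have h1 := mul_le_mul_of_nonneg_left hA hρ.le
    have h2 := mul_le_mul_of_nonneg_left hdesc (mul_pos ha hρ).le
    linarith
  refine le_trans ?_ hdecr
  by_cases hbig : min 1 (ζ * c₀) ≤ a
  · have h1 : min (min 1 (ζ * c₀)) (μ * ζ ^ 2) ≤ min 1 a :=
      (min_le_left _ _).trans (le_min (min_le_left _ _) hbig)
    have h2 : ρ * min (min 1 (ζ * c₀)) (μ * ζ ^ 2) * ε ≤ ρ * min 1 a * ε := by gcongr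
    have h3 : 0 ≤ ρ * (μ * (a * P ^ 2)) := by positivity
    linarith
  · rw [not_le, lt_min_iff] at hbig
    have h1 : √ε < a / ζ * P := by
      by_contra h1
      refine hnext.elim (fun h => hbig.1.ne h) fun h => h ?_
      refine lineSearchCriterion_of_first_order hf hρ' hx (fun i hi => Or.inl (hp i hi)) hμ1
        hdesc (by positivity) (not_lt.1 h1) ?_
      have h2 : a / ζ ≤ c₀ := (div_le_iff₀' hζ).2 hbig.2.le
      calc a / ζ * Lg ≤ c₀ * (Lg + 1) := by gcongr; linarith
        _ = (1 - ρ) * μ := div_mul_cancel₀ _ (by positivity)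
    have h2 : ζ ^ 2 * ε ≤ a * P ^ 2 := by
      rw [div_mul_eq_mul_div, lt_div_iff₀ hζ] at h1
      have h3 : (√ε * ζ) ^ 2 ≤ (a * P) ^ 2 := pow_le_pow_left₀ (by positivity) h1.le 2
      rw [mul_pow, Real.sq_sqrt hε.le] at h3
      have h4 : (a * P) ^ 2 = a * (a * P ^ 2) := by ring
      have h5 : a * (a * P ^ 2) ≤ a * P ^ 2 :=
        mul_le_of_le_one_left (by positivity) hbig.1.le
      linarith
    have h3 : ρ * min (min 1 (ζ * c₀)) (μ * ζ ^ 2) * ε ≤ ρ * (μ * ζ ^ 2) * ε := by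
      gcongr
      exact min_le_right _ _
    have h4 : ρ * μ * (ζ ^ 2 * ε) ≤ ρ * μ * (a * P ^ 2) := by gcongr
    have h5 : 0 ≤ ρ * (min 1 a * ε) := mul_nonneg hρ.le hmin0
    linarith

/-- A Type II step decreases `f` by a multiple of `ε ^ (3 / 2)`, unless it is a full SOL step so
short that the inactive part of the next gradient is small. -/
lemma decrease_typeII (hf : SmoothOnOrthant f Lg LH) (hσ : 0 < σ) (hω : 0 < ω) (hρ : 0 < ρ)
    (hρ' : ρ < 1 / 2) (hθ : 0 < θ) (hζ : 0 < ζ) (hε : 0 < ε) (hε1 : ε < 1)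
    (hx : ∀ i, 0 ≤ x i) (hR : ResidualRegularity f ρ θ ζ ε x₀ ω)
    (hK : KrylovRegularity f ρ θ ζ ε x₀ σ) (hact : IsActiveIterate f ρ θ ζ ε x₀ x)
    (hII : TypeII f ε x) (hp : ∀ i ∈ active x (√ε), p i = 0)
    (hcall : MinresCall f θ ε x t (subvec (inactive x (√ε)) p) D)
    (ha : 0 < a) (hcrit : LineSearchCriterion f ρ (√ε) x p a)
    (hnext : D = DType.SOL ∧ a = 1 ∨
      (D = DType.NPC ∨ a / ζ ≤ 1) ∧ ¬ LineSearchCriterion f ρ (√ε) x p (a / ζ))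
    {m κ m₂ : ℝ} (hm : m = min ω (1 / (Lg + θ * Lg / σ + 1)))
    (hκ : κ = ζ ^ 2 * ((1 / 2 - ρ) * min 1 σ / (LH + 1)))
    (hm₂ : m₂ = 1 / (θ * Lg / σ + LH + 1)) :
    ρ * min 1 σ * min (ζ * m) (min √(κ * m ^ 3) (m₂ ^ 2)) * √ε ^ 3 ≤
      f x - f (proj (x + a • p)) ∨ InactiveSmall f ε (proj (x + a • p)) := by
  have hLg := hf.Lg_nonneg
  have hLH := hf.LH_nonneg
  set μ := min 1 σ with hμ
  have hμ0 : 0 < μ := lt_min one_pos hσ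
  have hm0 : 0 < m := by rw [hm]; exact lt_min hω (by positivity)
  have hρ1 : 0 < 1 / 2 - ρ := by linarith
  have hκ0 : 0 < κ := by rw [hκ]; positivity
  have hm₂0 : 0 < m₂ := by rw [hm₂]; positivity
  set e := √ε with he
  have he0 : 0 < e := Real.sqrt_pos.2 hε
  have he1 : e ≤ 1 := Real.sqrt_le_one.2 hε1.le
  have he2 : e ^ 2 = ε := Real.sq_sqrt hε.le
  have hdesc := MinresCall.descent hf hθ hK hact hcall
  have hPlow : m * ε ≤ ‖subvec (inactive x e) p‖ := by
    have hg : ε ≤ ‖subvec (inactive x e) (gradient f x)‖ := (not_le.1 hII.2.2).le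
    cases D with
    | NPC =>
      refine le_trans ?_ (hR x hact t _ hcall)
      exact mul_le_mul (hm ▸ min_le_left _ _) hg hε.le hω.le
    | SOL =>
      have h1 := MinresCall.norm_gradient_le hf hθ hσ hx hε1 hK hact hcall
      have h2 : 0 < Lg + θ * Lg / σ + 1 := by positivity
      calc m * ε ≤ 1 / (Lg + θ * Lg / σ + 1) * ε := by
            gcongr
            rw [hm]; exact min_le_right _ _
        _ = ε / (Lg + θ * Lg / σ + 1) := by ring
        _ ≤ _ := (div_le_iff₀' h2).2 (hg.trans h1)
  have hdecr : ρ * μ * (a * ‖subvec (inactive x e) p‖ ^ 2) ≤ f x - f (proj (x + a • p)) := by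
    rw [LineSearchCriterion] at hcrit
    have h1 := inner_active_nonpos (g := gradient f x) ha hx (fun i hi => Or.inr (hp i hi))
    have h2 := mul_nonpos_of_nonneg_of_nonpos hρ.le h1
    have h3 := mul_le_mul_of_nonneg_left hdesc (mul_pos ha hρ).le
    linarith
  have hle : ∀ {C : ℝ}, min (ζ * m) (min √(κ * m ^ 3) (m₂ ^ 2)) ≤ C →
      C * e ^ 3 ≤ a * ‖subvec (inactive x e) p‖ ^ 2 →
      ρ * μ * min (ζ * m) (min √(κ * m ^ 3) (m₂ ^ 2)) * e ^ 3 ≤ f x - f (proj (x + a • p)) := by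
    intro C hC h
    refine le_trans ?_ hdecr
    rw [mul_assoc (ρ * μ)]
    refine mul_le_mul_of_nonneg_left (le_trans ?_ h) (by positivity)
    gcongr
  rcases hnext with ⟨rfl, rfl⟩ | ⟨haD, hnext⟩
  · by_cases hP : ‖subvec (inactive x e) p‖ ≤ m₂ * e
    · right
      have hm₂1 : m₂ ≤ 1 := by
        rw [hm₂, div_le_one (by positivity)]
        have : 0 ≤ θ * Lg / σ := by positivity
        linarith
      have hPe : ‖subvec (inactive x e) p‖ ≤ e :=
        hP.trans (mul_le_of_le_one_left he0.le hm₂1)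
      set pI := subvec (inactive x e) p with hpI
      have hstep : proj (x + (1 : ℝ) • p) - x = extendZero (inactive x e) pI := by
        rw [proj_sub_eq_extendZero zero_le_one hx hp (by rwa [one_mul]), one_smul]
      have hsub : inactive (proj (x + (1 : ℝ) • p)) e ⊆ inactive x e := by
        intro i hi
        by_contra hni
        have h1 := congrArg (fun v => v i) hstep
        simp only [extendZero_apply, dif_neg hni] at h1
        rw [mem_inactive] at hi hni
        have h2 : proj (x + (1 : ℝ) • p) i = x i := sub_eq_zero.1 h1
        exact hni (h2 ▸ hi)
      have h1 := norm_gradient_sub_le hf.contDiff hf.LH_nonneg hf.hess_lipschitz hx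
        (proj_nonneg (x + (1 : ℝ) • p))
      rw [hstep, norm_extendZero] at h1
      have h2 := (norm_subvec_le (inactive x e) _).trans h1
      have h3 := MinresCall.norm_residual_le hf hθ hσ hx hK hact hcall
      have h4 : subvec (inactive x e) (gradient f (proj (x + (1 : ℝ) • p))) =
          subvec (inactive x e) (gradient f (proj (x + (1 : ℝ) • p)) - gradient f x -
            hess f x (extendZero (inactive x e) pI)) +
          (subHess f (inactive x e) x pI + subvec (inactive x e) (gradient f x)) := by
        rw [subHess_apply]
        ext i
        simp only [subvec_apply, WithLp.ofLp_add, WithLp.ofLp_sub, Pi.add_apply, Pi.sub_apply]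
        ring
      refine (norm_subvec_mono hsub _).trans ?_
      rw [h4]
      refine (norm_add_le _ _).trans ?_
      have h5 : LH * ‖pI‖ ^ 2 ≤ LH * (e * ‖pI‖) := by
        rw [sq]
        gcongr
      have h6 : (θ * Lg / σ + LH + 1) * m₂ = 1 := by
        rw [hm₂]; exact mul_one_div_cancel (by positivity)
      calc _ ≤ LH * (e * ‖pI‖) + θ * Lg / σ * e * ‖pI‖ := add_le_add (h2.trans h5) h3
        _ ≤ (θ * Lg / σ + LH + 1) * e * ‖pI‖ := by
          have := mul_nonneg he0.le (norm_nonneg pI)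
          linarith
        _ ≤ (θ * Lg / σ + LH + 1) * e * (m₂ * e) := by gcongr
        _ = (θ * Lg / σ + LH + 1) * m₂ * e ^ 2 := by ring
        _ = ε := by rw [h6, he2, one_mul]
    · left
      refine hle ((min_le_right _ _).trans (min_le_right _ _)) ?_
      have h1 := pow_le_pow_left₀ (by positivity) (not_le.1 hP).le 2
      calc m₂ ^ 2 * e ^ 3 = (m₂ * e) ^ 2 * e := by ring
        _ ≤ (m₂ * e) ^ 2 * 1 := by gcongr
        _ ≤ _ := by linarith
  · left
    set P := ‖subvec (inactive x e) p‖ with hP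
    have hP0 : 0 ≤ P := norm_nonneg _
    have haζ : 0 < a / ζ := by positivity
    by_cases h1 : a / ζ * P ≤ e
    · -- The trial `a / ζ` was rejected because of the third-order term, so `a ^ 2 * P` is large.
      have h2 : (1 / 2 - ρ) * μ < LH * ((a / ζ) ^ 2 * P) := by
        by_contra h2
        exact hnext (lineSearchCriterion_of_second_order hf hx hρ'.le hp hdesc haζ h1
          (MinresCall.curvature hf hθ hσ hK hact hcall haζ haD) (not_lt.1 h2))
      have h3 : κ ≤ a ^ 2 * P := by
        have h4 : LH * ((a / ζ) ^ 2 * P) ≤ (LH + 1) * ((a / ζ) ^ 2 * P) := by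
          gcongr; linarith
        have h5 : (1 / 2 - ρ) * μ / (LH + 1) ≤ (a / ζ) ^ 2 * P :=
          (div_le_iff₀' (by positivity)).2 (h2.le.trans h4)
        calc κ ≤ ζ ^ 2 * ((a / ζ) ^ 2 * P) := by rw [hκ]; gcongr
          _ = a ^ 2 * P := by field_simp
      refine hle ((min_le_right _ _).trans (min_le_left _ _)) ?_
      refine le_of_sq_le_sq ?_ (by positivity)
      calc (√(κ * m ^ 3) * e ^ 3) ^ 2 = κ * (m * e ^ 2) ^ 3 := by
            rw [mul_pow, Real.sq_sqrt (by positivity)]; ring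
        _ ≤ (a ^ 2 * P) * P ^ 3 := by rw [he2]; gcongr
        _ = (a * P ^ 2) ^ 2 := by ring
    · refine hle (min_le_left _ _) ?_
      rw [not_le, div_mul_eq_mul_div, lt_div_iff₀ hζ] at h1
      calc ζ * m * e ^ 3 = (e * ζ) * (m * e ^ 2) := by ring
        _ ≤ (a * P) * P := by rw [he2]; gcongr
        _ = a * P ^ 2 := by ring

end StepSize

/-! ### Runs of the algorithm -/

section Runs

variable {d : ℕ} {f : EuclideanSpace ℝ (Fin d) → ℝ} {Lg LH σ ω ρ θ ζ ε τ ν fstar : ℝ}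
  {x₀ x y : EuclideanSpace ℝ (Fin d)} {t : ℕ}

lemma IsRun.nonneg (hx₀ : ∀ i, 0 ≤ x₀ i) {K : ℕ} {z : ℕ → EuclideanSpace ℝ (Fin d)} {hv : ℕ → ℕ}
    (h : IsRun f ρ θ ζ ε x₀ K z hv) {k : ℕ} (hk : k ≤ K) : ∀ i, 0 ≤ z k i := by
  cases k with
  | zero => rw [h.1]; exact hx₀
  | succ k =>
    obtain ⟨p, D, a, -, -, -, hy⟩ := h.2 k hk
    rw [hy]
    exact proj_nonneg _

lemma Step.not_terminates (h : Step f ρ θ ζ ε x y t) : ¬ Terminates f ε x := by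
  obtain ⟨p, D, a, h | h, -⟩ := h
  · exact fun ht => ht.1 h.1
  · exact fun ht => ht.2 h.1

lemma IsRun.isActiveIterate {K : ℕ} {z : ℕ → EuclideanSpace ℝ (Fin d)} {hv : ℕ → ℕ}
    (h : IsRun f ρ θ ζ ε x₀ K z hv) {k : ℕ} (hk : k ≤ K) (ht : ¬ Terminates f ε (z k)) :
    IsActiveIterate f ρ θ ζ ε x₀ (z k) :=
  ⟨ht, k, z, hv, ⟨h.1, fun j hj => h.2 j (hj.trans_le hk)⟩, rfl⟩

/-- The MINRES call at an active iterate passes the inexactness test within `2 k + 2` iterations. -/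
lemma exists_solTest_of_isActiveIterate (hf : SmoothOnOrthant f Lg LH) (hθ : 0 < θ) (hτ : 0 < τ)
    (hε : 0 < ε) (hx : ∀ i, 0 ≤ x i) (hS : SpectralRegularity f ρ θ ζ ε x₀ τ ν)
    (hν : Lg ^ 2 / (Lg ^ 2 + (θ * √ε) ^ 2) ≤ ν) (hact : IsActiveIterate f ρ θ ζ ε x₀ x) {k : ℕ}
    (hk : τ ≤ Lg → (1 - τ ^ 2 / Lg ^ 2) ^ (2 * k) * (Lg ^ 2 + (θ * √ε) ^ 2) ^ 2 ≤
      (θ * √ε) ^ 2 * Lg ^ 2) (s : ℕ → EuclideanSpace ℝ (inactive x (√ε)))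
    (hs : ∀ j, IsMinresIterate (subHess f (inactive x (√ε)) x)
      (subvec (inactive x (√ε)) (gradient f x)) j (s j)) :
    ∃ j ≤ 2 * k + 2, SOLTest (subHess f (inactive x (√ε)) x)
      (subvec (inactive x (√ε)) (gradient f x)) (θ * √ε) (s j) :=
  exists_solTest (isSymmetric_subHess hf.contDiff _ _) hf.Lg_nonneg
    (norm_subHess_le (norm_hess_le hf.contDiff hf.Lg_nonneg hf.gradient_lipschitz hx)) hτ
    (mul_pos hθ (Real.sqrt_pos.2 hε)) hν (hS x hact) hk s hs

/-- The line search terminates: short steps are accepted, and along an NPC direction the required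
decrease exceeds `f x - fstar` eventually. -/
lemma exists_stepSize (hf : SmoothOnOrthant f Lg LH) (hσ : 0 < σ) (hρ : 0 < ρ) (hρ' : ρ < 1)
    (hθ : 0 < θ) (hζ : 0 < ζ) (hζ' : ζ < 1) (hε : 0 < ε)
    (hbdd : ∀ x : EuclideanSpace ℝ (Fin d), (∀ i, 0 ≤ x i) → fstar ≤ f x) (hx : ∀ i, 0 ≤ x i)
    (hK : KrylovRegularity f ρ θ ζ ε x₀ σ) (hact : IsActiveIterate f ρ θ ζ ε x₀ x)
    {p : EuclideanSpace ℝ (Fin d)} {D : DType}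
    (hp : ∀ i ∈ active x (√ε), p i = -gradient f x i ∨ p i = 0)
    (hcall : MinresCall f θ ε x t (subvec (inactive x (√ε)) p) D) :
    ∃ a, match D with
      | DType.SOL => BackTracking (LineSearchCriterion f ρ (√ε) x p) ζ a
      | DType.NPC => ForwardTracking (LineSearchCriterion f ρ (√ε) x p) ζ a := by
  have hLg := hf.Lg_nonneg
  have hμ0 : 0 < min 1 σ := lt_min one_pos hσ
  have he0 : 0 < √ε := Real.sqrt_pos.2 hε
  have hρ1 : 0 < 1 - ρ := by linarith
  set P := ‖subvec (inactive x (√ε)) p‖ with hP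
  have hP0 : 0 ≤ P := norm_nonneg _
  set a₀ := min ((1 - ρ) * min 1 σ / (Lg + 1)) (√ε / (P + 1)) with ha₀
  have ha₀0 : 0 < a₀ := lt_min (by positivity) (by positivity)
  have hsmall : ∀ a, 0 < a → a ≤ a₀ → LineSearchCriterion f ρ (√ε) x p a := by
    intro a ha haa
    refine lineSearchCriterion_of_first_order hf hρ' hx hp (min_le_left 1 σ)
      (MinresCall.descent hf hθ hK hact hcall) ha ?_ ?_
    · calc a * P ≤ √ε / (P + 1) * (P + 1) := by
            gcongr
            · exact haa.trans (min_le_right _ _)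
            · linarith
        _ = √ε := div_mul_cancel₀ _ (by positivity)
    · calc a * Lg ≤ (1 - ρ) * min 1 σ / (Lg + 1) * (Lg + 1) := by
            gcongr
            · exact haa.trans (min_le_left _ _)
            · linarith
        _ = (1 - ρ) * min 1 σ := div_mul_cancel₀ _ (by positivity)
  cases D with
  | SOL => exact exists_backTracking hζ hζ' ha₀0 hsmall
  | NPC =>
    obtain ⟨-, h1, h2⟩ := MinresReturns.npc hcall
    have hPpos : 0 < P := norm_pos_iff.2 h2
    refine exists_forwardTracking hζ hζ' ha₀0 (a₁ := max 0 ((f x - fstar) / (ρ * P ^ 2))) hsmall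
      fun a ha hcrit => ?_
    obtain ⟨ha0, ha1⟩ := max_lt_iff.1 ha
    rw [div_lt_iff₀ (by positivity)] at ha1
    rw [LineSearchCriterion, h1] at hcrit
    have h3 := mul_nonpos_of_nonneg_of_nonpos hρ.le
      (inner_active_nonpos (g := gradient f x) ha0 hx hp)
    have h4 := hbdd _ (proj_nonneg (x + a • p))
    linarith

lemma exists_step (hf : SmoothOnOrthant f Lg LH) (hσ : 0 < σ) (hρ : 0 < ρ) (hρ' : ρ < 1)
    (hθ : 0 < θ) (hζ : 0 < ζ) (hζ' : ζ < 1) (hτ : 0 < τ) (hε : 0 < ε)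
    (hbdd : ∀ x : EuclideanSpace ℝ (Fin d), (∀ i, 0 ≤ x i) → fstar ≤ f x) (hx : ∀ i, 0 ≤ x i)
    (hK : KrylovRegularity f ρ θ ζ ε x₀ σ) (hS : SpectralRegularity f ρ θ ζ ε x₀ τ ν)
    (hν : Lg ^ 2 / (Lg ^ 2 + (θ * √ε) ^ 2) ≤ ν) (hact : IsActiveIterate f ρ θ ζ ε x₀ x) {k : ℕ}
    (hk : τ ≤ Lg → (1 - τ ^ 2 / Lg ^ 2) ^ (2 * k) * (Lg ^ 2 + (θ * √ε) ^ 2) ^ 2 ≤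
      (θ * √ε) ^ 2 * Lg ^ 2) : ∃ y t, Step f ρ θ ζ ε x y t := by
  classical
  obtain ⟨t, q, D, hcall⟩ := exists_minresReturns
    (exists_solTest_of_isActiveIterate hf hθ hτ hε hx hS hν hact hk)
  have key : ∀ c : Fin d → ℝ, (∀ i, c i = -gradient f x i ∨ c i = 0) →
      ((TypeI f ε x ∧ ∀ i ∈ active x (√ε), c i = -gradient f x i) ∨
        (TypeII f ε x ∧ ∀ i ∈ active x (√ε), c i = 0)) → ∃ y t, Step f ρ θ ζ ε x y t := by
    intro c hc hcase
    set p : EuclideanSpace ℝ (Fin d) :=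
      WithLp.toLp 2 fun i => if h : i ∈ inactive x (√ε) then q ⟨i, h⟩ else c i with hpdef
    have hpI : subvec (inactive x (√ε)) p = q := by
      ext i
      simp [hpdef]
    have hpA : ∀ i ∈ active x (√ε), p i = c i := fun i hi => by
      have : i ∉ inactive x (√ε) := by
        rw [inactive_eq_compl hx, Finset.mem_compl, not_not]; exact hi
      simp [hpdef, this]
    have hcall' : MinresCall f θ ε x t (subvec (inactive x (√ε)) p) D := by rw [hpI]; exact hcall
    obtain ⟨a, ha⟩ := exists_stepSize hf hσ hρ hρ' hθ hζ hζ' hε hbdd hx hK hact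
      (fun i hi => by rw [hpA i hi]; exact hc i) hcall'
    refine ⟨_, t, p, D, a, ?_, hcall', ha, rfl⟩
    exact hcase.imp (fun h => ⟨h.1, fun i hi => (hpA i hi).trans (h.2 i hi)⟩)
      fun h => ⟨h.1, fun i hi => (hpA i hi).trans (h.2 i hi)⟩
  by_cases hI : TypeI f ε x
  · exact key (fun i => -gradient f x i) (fun _ => Or.inl rfl) (Or.inl ⟨hI, fun _ _ => rfl⟩)
  · have hII : TypeII f ε x := by
      by_contra hII
      exact hact.1 ⟨hI, hII⟩
    exact key (fun _ => 0) (fun _ => Or.inr rfl) (Or.inr ⟨hII, fun _ _ => rfl⟩)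

/-- The tests of the algorithm require nonempty index sets; the conditions on empty ones hold
trivially. -/
lemma Terminates.isFO (hε : 0 < ε) (h : Terminates f ε x) : IsFO f ε x := by
  obtain ⟨hI, hII⟩ := h
  have hempty : ∀ (I : Finset (Fin d)) (v : EuclideanSpace ℝ (Fin d)), ¬ I.Nonempty →
      ‖subvec I v‖ ≤ ε := by
    intro I v hne
    rw [Finset.not_nonempty_iff_eq_empty] at hne
    subst hne
    have : ‖subvec ∅ v‖ ^ 2 = 0 := by rw [norm_sq_subvec, Finset.sum_empty]
    rw [pow_eq_zero_iff two_ne_zero] at this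
    rw [this]; exact hε.le
  have h1 : ActiveSign f ε x ∧ ActiveCompl f ε x := by
    by_cases hne : (active x (√ε)).Nonempty
    · by_contra hn
      exact hI ⟨hne, not_and_or.1 hn⟩
    · exact ⟨fun i hi => absurd ⟨i, hi⟩ hne, hempty _ _ hne⟩
  refine ⟨h1.1, h1.2, ?_⟩
  by_cases hne : (inactive x (√ε)).Nonempty
  · by_contra hn
    exact hII ⟨hI, hne, hn⟩
  · exact hempty _ _ hne

/-- The decrease per step has a positive rate that depends on the constants of the problem class
only. -/
lemma exists_decrease_rate (hLg : 0 ≤ Lg) (hLH : 0 ≤ LH) (hσ : 0 < σ) (hω : 0 < ω) (hρ : 0 < ρ)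
    (hρ' : ρ < 1 / 2) (hθ : 0 < θ) (hζ : 0 < ζ) (hζ' : ζ < 1) :
    ∃ c : ℝ, 0 < c ∧ ∀ {d : ℕ} {f : EuclideanSpace ℝ (Fin d) → ℝ} {ε : ℝ}
      {x₀ x y : EuclideanSpace ℝ (Fin d)} {t : ℕ}, SmoothOnOrthant f Lg LH → 0 < ε → ε < 1 →
      (∀ i, 0 ≤ x i) → ResidualRegularity f ρ θ ζ ε x₀ ω → KrylovRegularity f ρ θ ζ ε x₀ σ →
      IsActiveIterate f ρ θ ζ ε x₀ x → Step f ρ θ ζ ε x y t →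
      f y ≤ f x ∧ (c * √ε ^ 3 ≤ f x - f y ∨ ¬ TypeI f ε x ∧ InactiveSmall f ε y) := by
  have hρ1 : 0 < 1 - ρ := by linarith
  have hρ2 : 0 < 1 / 2 - ρ := by linarith
  have hμ0 : 0 < min 1 σ := lt_min one_pos hσ
  set m := min ω (1 / (Lg + θ * Lg / σ + 1)) with hm
  have hm0 : 0 < m := lt_min hω (by positivity)
  set κ := ζ ^ 2 * ((1 / 2 - ρ) * min 1 σ / (LH + 1)) with hκ
  have hκ0 : 0 < κ := by positivity
  set m₂ := 1 / (θ * Lg / σ + LH + 1) with hm₂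
  have hm₂0 : 0 < m₂ := by positivity
  set c₁ := ρ * min (min 1 (ζ * ((1 - ρ) * min 1 σ / (Lg + 1)))) (min 1 σ * ζ ^ 2) with hc₁
  set c₂ := ρ * min 1 σ * min (ζ * m) (min √(κ * m ^ 3) (m₂ ^ 2)) with hc₂
  have hc₁0 : 0 < c₁ :=
    mul_pos hρ (lt_min (lt_min one_pos (by positivity)) (by positivity))
  have hc₂0 : 0 < c₂ :=
    mul_pos (by positivity) (lt_min (by positivity)
      (lt_min (Real.sqrt_pos.2 (by positivity)) (by positivity)))
  refine ⟨min c₁ c₂, lt_min hc₁0 hc₂0, ?_⟩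
  intro d f ε x₀ x y t hf hε hε1 hx hR hK hact hstep
  obtain ⟨p, D, a, hcase, hcall, hsearch, rfl⟩ := hstep
  obtain ⟨ha, hcrit, hnext⟩ := stepSize_spec hζ hζ' hsearch
  have he0 : 0 < √ε := Real.sqrt_pos.2 hε
  have he1 : √ε ≤ 1 := Real.sqrt_le_one.2 hε1.le
  have hpA : ∀ i ∈ active x (√ε), p i = -gradient f x i ∨ p i = 0 := fun i hi =>
    hcase.imp (fun h => h.2 i hi) (fun h => h.2 i hi)
  refine ⟨?_, ?_⟩
  · rw [LineSearchCriterion] at hcrit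
    have h1 := mul_nonpos_of_nonneg_of_nonpos hρ.le
      (inner_active_nonpos (g := gradient f x) ha hx hpA)
    have h2 : inner ℝ (subvec (inactive x (√ε)) (gradient f x)) (subvec (inactive x (√ε)) p) ≤ 0 :=
      (MinresCall.descent hf hθ hK hact hcall).trans (neg_nonpos.2 (by positivity))
    have h3 := mul_nonpos_of_nonneg_of_nonpos (mul_pos ha hρ).le h2
    linarith
  · rcases hcase with ⟨hI, hp⟩ | ⟨hII, hp⟩
    · left
      have h1 := decrease_typeI hf hσ hρ (by linarith) hθ hζ hε hx hK hact hI hp hcall ha hcrit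
        (hnext.imp (fun h => h.2) fun h => h.2)
      refine le_trans ?_ h1
      have h2 : √ε ^ 3 ≤ ε := by
        calc √ε ^ 3 = √ε ^ 2 * √ε := by ring
          _ ≤ √ε ^ 2 * 1 := by gcongr
          _ = ε := by rw [mul_one, Real.sq_sqrt hε.le]
      exact mul_le_mul (min_le_left _ _) h2 (by positivity) hc₁0.le
    · refine (decrease_typeII hf hσ hω hρ hρ' hθ hζ hε hε1 hx hR hK hact hII hp hcall ha hcrit hnext
        hm hκ hm₂).imp (fun h => ?_) fun h => ⟨hII.1, h⟩
      refine le_trans ?_ h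
      exact mul_le_mul_of_nonneg_right (min_le_right _ _) (by positivity)

/-- If any two consecutive steps together decrease the objective by `c`, the number of steps is
bounded by the total decrease available. -/
lemma mul_le_of_two_step_decrease {F : ℕ → ℝ} {K : ℕ} {c Δ : ℝ} (hc : 0 < c)
    (hstep : ∀ k, k + 1 < K → F (k + 2) + c ≤ F k) (hΔ : ∀ k ≤ K, F 0 - F k ≤ Δ) :
    K * c ≤ 2 * Δ + c := by
  have hind : ∀ m : ℕ, 2 * m ≤ K → F (2 * m) + m * c ≤ F 0 := by
    intro m
    induction m with
    | zero => intro _; simp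
    | succ m ih =>
      intro hm
      have h1 := hstep (2 * m) (by omega)
      have h2 := ih (by omega)
      have e : 2 * (m + 1) = 2 * m + 2 := by ring
      rw [e]
      push_cast
      linarith
  have h1 := hind (K / 2) (by omega)
  have h2 := hΔ (2 * (K / 2)) (by omega)
  have h3 : (K : ℝ) ≤ 2 * (K / 2 : ℕ) + 1 := by
    have : K ≤ 2 * (K / 2) + 1 := by omega
    exact_mod_cast this
  nlinarith

end Runs

end NewtonMR

theorem mainTheorem3
    (Lg LH σ ω ρ θ ζ τ Δ : ℝ) (hLg : 0 ≤ Lg) (hLH : 0 ≤ LH) (hσ : 0 < σ) (hω : 0 < ω)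
    (hρ : 0 < ρ) (hρ' : ρ < 1 / 2) (hθ : 0 < θ) (hζ : 0 < ζ) (hζ' : ζ < 1) (hτ : 0 < τ) :
    ∃ C : ℝ, ∀ (d : ℕ) (f : EuclideanSpace ℝ (Fin d) → ℝ) (fstar : ℝ)
      (x₀ : EuclideanSpace ℝ (Fin d)) (ε ν : ℝ),
      ContDiff ℝ 2 f →
      (∀ x y : EuclideanSpace ℝ (Fin d), (∀ i, 0 ≤ x i) → (∀ i, 0 ≤ y i) →
        ‖gradient f x - gradient f y‖ ≤ Lg * ‖x - y‖) →
      (∀ x y : EuclideanSpace ℝ (Fin d), (∀ i, 0 ≤ x i) → (∀ i, 0 ≤ y i) →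
        ‖hess f x - hess f y‖ ≤ LH * ‖x - y‖) →
      (∀ x : EuclideanSpace ℝ (Fin d), (∀ i, 0 ≤ x i) → fstar ≤ f x) →
      (∀ i, 0 ≤ x₀ i) →
      f x₀ - fstar ≤ Δ →
      0 < ε → ε < 1 →
      ResidualRegularity f ρ θ ζ ε x₀ ω →
      KrylovRegularity f ρ θ ζ ε x₀ σ →
      Lg ^ 2 / (Lg ^ 2 + (θ * √ε) ^ 2) < ν → ν ≤ 1 →
      SpectralRegularity f ρ θ ζ ε x₀ τ ν →
      (∃ K x hv, IsRun f ρ θ ζ ε x₀ K x hv ∧ Terminates f ε (x K)) ∧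
      ∀ K x hv, IsRun f ρ θ ζ ε x₀ K x hv →
        (oracleCalls K hv : ℝ) ≤ C * ε ^ (-(3 / 2 : ℝ)) * (1 + Real.log (1 / ε)) ∧
        (Terminates f ε (x K) → (∀ i, 0 ≤ x K i) ∧ IsFO f ε (x K)) ∧
        (¬ Terminates f ε (x K) → ∃ y t, Step f ρ θ ζ ε (x K) y t) := by
  obtain ⟨c, hc, hrate⟩ := exists_decrease_rate hLg hLH hσ hω hρ hρ' hθ hζ hζ'
  obtain ⟨C₂, hC₂, hdeg⟩ := exists_filter_degree (L := Lg) hτ hθ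
  refine ⟨(2 * |Δ| / c + 2) * (C₂ + 1), ?_⟩
  intro d f fstar x₀ ε ν hfC hgLip hhLip hbdd hx₀ hΔ hε hε1 hR hK hν _ hS
  have hf : SmoothOnOrthant f Lg LH := ⟨hfC, hLg, hLH, hgLip, hhLip⟩
  obtain ⟨k, hkC, hk⟩ := hdeg ε hε hε1
  have he0 : 0 < √ε := Real.sqrt_pos.2 hε
  have hlog : 0 ≤ Real.log (1 / ε) :=
    Real.log_nonneg (by rw [one_div]; exact (one_le_inv₀ hε).2 hε1.le)
  have hpow : ε ^ (-(3 / 2 : ℝ)) = (√ε ^ 3)⁻¹ := by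
    rw [Real.rpow_neg hε.le, Real.sqrt_eq_rpow, ← Real.rpow_natCast, ← Real.rpow_mul hε.le]
    norm_num
  have hnext : ∀ {K x hv}, IsRun f ρ θ ζ ε x₀ K x hv → ¬ Terminates f ε (x K) →
      ∃ y t, Step f ρ θ ζ ε (x K) y t := fun {K x hv} hrun ht =>
    exists_step hf hσ hρ (by linarith) hθ hζ hζ' hτ hε hbdd (hrun.nonneg hx₀ le_rfl) hK hS hν.le
      (hrun.isActiveIterate le_rfl ht) hk
  have hlen : ∀ {K x hv}, IsRun f ρ θ ζ ε x₀ K x hv → (K : ℝ) * (c * √ε ^ 3) ≤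
      2 * |Δ| + c * √ε ^ 3 := by
    intro K x hv hrun
    refine mul_le_of_two_step_decrease (F := fun j => f (x j)) (by positivity) ?_ ?_
    · intro j hj
      have hstep : ∀ i < K, f (x (i + 1)) ≤ f (x i) ∧ (c * √ε ^ 3 ≤ f (x i) - f (x (i + 1)) ∨
          ¬ TypeI f ε (x i) ∧ InactiveSmall f ε (x (i + 1))) := fun i hi =>
        hrate hf hε hε1 (hrun.nonneg hx₀ hi.le) hR hK
          (hrun.isActiveIterate hi.le (hrun.2 i hi).not_terminates) (hrun.2 i hi)
      obtain ⟨h1, h2⟩ := hstep j (by omega)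
      obtain ⟨h3, h4⟩ := hstep (j + 1) hj
      have e : x (j + 1 + 1) = x (j + 2) := rfl
      rw [e] at h3 h4
      rcases h2 with h2 | ⟨-, h2⟩
      · show f (x (j + 2)) + _ ≤ f (x j)
        linarith
      · rcases h4 with h4 | ⟨h4, -⟩
        · show f (x (j + 2)) + _ ≤ f (x j)
          linarith
        -- A step that leaves the inactive gradient small is followed by a Type I step or none.
        · exact absurd ⟨h4, fun h => h.2.2 h2⟩ (hrun.2 (j + 1) hj).not_terminates
    · intro j hj
      show f (x 0) - f (x j) ≤ |Δ|
      rw [hrun.1]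
      have := hbdd _ (hrun.nonneg hx₀ hj)
      linarith [le_abs_self Δ]
  refine ⟨?_, fun K x hv hrun => ⟨?_, fun ht => ⟨hrun.nonneg hx₀ le_rfl, ht.isFO hε⟩,
    hnext hrun⟩⟩
  · by_contra! hno
    have hall : ∀ n : ℕ, ∃ x hv, IsRun f ρ θ ζ ε x₀ n x hv := by
      intro n
      induction n with
      | zero => exact ⟨fun _ => x₀, fun _ => 0, rfl, fun j hj => absurd hj (Nat.not_lt_zero j)⟩
      | succ n ih =>
        obtain ⟨x, hv, hrun⟩ := ih
        obtain ⟨y, t, hy⟩ := hnext hrun (hno n x hv hrun)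
        refine ⟨fun j => if j ≤ n then x j else y, fun j => if j < n then hv j else t, ?_, ?_⟩
        · simpa using hrun.1
        · intro j hj
          rcases Nat.lt_succ_iff_lt_or_eq.1 hj with h | rfl
          · have h1 : j + 1 ≤ n := h
            simpa [h, h.le, h1] using hrun.2 j h
          · simpa using hy
    obtain ⟨n, hn⟩ := exists_nat_gt ((2 * |Δ| + c * √ε ^ 3) / (c * √ε ^ 3))
    obtain ⟨x, hv, hrun⟩ := hall n
    rw [div_lt_iff₀ (by positivity)] at hn
    linarith [hlen hrun]
  · have hhv : ∀ j ∈ Finset.range K, (hv j : ℝ) ≤ C₂ * (1 + Real.log (1 / ε)) := by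
      intro j hj
      have hj' := Finset.mem_range.1 hj
      have hact := hrun.isActiveIterate hj'.le (hrun.2 j hj').not_terminates
      obtain ⟨p, D, a, -, hcall, -⟩ := hrun.2 j hj'
      have h1 : hv j ≤ 2 * k + 2 + 1 := MinresReturns.le_of_solTest
        (exists_solTest_of_isActiveIterate hf hθ hτ hε (hrun.nonneg hx₀ hj'.le) hS hν.le hact hk)
        hcall
      refine le_trans ?_ hkC
      exact_mod_cast h1
    have hsum : (∑ j ∈ Finset.range K, (hv j : ℝ)) ≤ K * (C₂ * (1 + Real.log (1 / ε))) := by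
      have := Finset.sum_le_card_nsmul _ _ _ hhv
      rwa [Finset.card_range, nsmul_eq_mul] at this
    have hK1 : (K : ℝ) + 1 ≤ (2 * |Δ| / c + 2) * (√ε ^ 3)⁻¹ := by
      have h1 := hlen hrun
      have h2 : √ε ^ 3 ≤ 1 := pow_le_one₀ he0.le (Real.sqrt_le_one.2 hε1.le)
      rw [← div_eq_mul_inv, le_div_iff₀ (by positivity)]
      have h3 : (K : ℝ) * √ε ^ 3 ≤ 2 * |Δ| / c + √ε ^ 3 := by
        rw [← sub_le_iff_le_add, le_div_iff₀ hc]
        linarith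
      linarith
    rw [oracleCalls, hpow]
    push_cast
    have hone : (1 : ℝ) ≤ 1 + Real.log (1 / ε) := by linarith
    have hK0 : (0 : ℝ) ≤ K := Nat.cast_nonneg K
    calc (K : ℝ) + 1 + ∑ j ∈ Finset.range K, (hv j : ℝ)
        ≤ ((K : ℝ) + 1) * (1 + Real.log (1 / ε)) +
            ((K : ℝ) + 1) * (C₂ * (1 + Real.log (1 / ε))) := by
          have h1 : (K : ℝ) + 1 ≤ ((K : ℝ) + 1) * (1 + Real.log (1 / ε)) :=
            le_mul_of_one_le_right (by positivity) hone
          have h2 : 0 ≤ C₂ * (1 + Real.log (1 / ε)) := by positivity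
          linarith
      _ = ((K : ℝ) + 1) * ((C₂ + 1) * (1 + Real.log (1 / ε))) := by ring
      _ ≤ ((2 * |Δ| / c + 2) * (√ε ^ 3)⁻¹) * ((C₂ + 1) * (1 + Real.log (1 / ε))) := by
          gcongr
      _ = _ := by ring
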